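/- Let $m\ge 3$, let $U$ be a smooth $m$-manifold (for instance an open subset of a given $m$-manifold) and let $f\colon U\to\mathbf R^{m+1}$ be a front: $f$ is $C^\infty$, and each point of $U$ has a neighbourhood on which there is a smooth unit vector field $\nu$ along $f$ with $\langle df(X),\nu\rangle=0$ for all tangent vectors $X$, such that $(f,\nu)$ is an immersion into the unit tangent bundle $\mathbf R^{m+1}\times S^m$. Let $\Sigma_f$ be the singular set of $f$, that is, the set of points $p$ at which $df_p$ is not injective. Suppose that every $p\in\Sigma_f$ is an $A_2$-point: the function $\lambda=\det(\partial_1 f,\dots,\partial_m f,\nu)$, formed in local coordinates at $p$, satisfies $d\lambda(p)\ne 0$ (so that near $p$ the set $\Sigma_f$ is an $(m-1)$-dimensional submanifold), and the null direction $\ker df_p$ is transversal to $\Sigma_f$ at $p$. Then $\Sigma_f$ is a smooth $(m-1)$-dimensional submanifold of $U$ (the singular submanifold), the metric $ds^2=f^*\langle\ ,\ \rangle$ induced by $f$ is positive definite on $\Sigma_f$, and the following hold, where $K$ denotes the sectional curvature of $ds^2$ on the regular set $U\setminus\Sigma_f$, and the sectional curvature of $\Sigma_f$ is that of the restriction of $ds^2$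 to $\Sigma_f$. 1. If $K>0$ for all tangent planes at all points of $U\setminus\Sigma_f$, then the sectional curvature of $\Sigma_f$ is non-negative. 2. If there is a constant $\delta>0$ such that $K\ge\delta$ for all tangent planes at all points of $U\setminus\Sigma_f$, then the sectional curvature of $\Sigma_f$ is positive. More generally, the sectional curvature of $\Sigma_f$ is positive if each $p\in\Sigma_f$ has an open neighbourhood $O$ with a smooth vector field $\tilde\eta$ on $O$ and a constant $\delta>0$ such that $\tilde\eta\neq0$ and $df(\tilde\eta)=0$ at all points of $O\cap\Sigma_f$, and $K(X\wedge\tilde\eta)\ge\delta$ for every tangent vector $X$ linearly independent of $\tilde\eta$ at a point of $O\setminus\Sigma_f$. -/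

import Mathlib

open scoped Manifold ContDiff

noncomputable section

namespace WaveFront

/-- Euclidean space `ℝⁿ`. -/
abbrev Euc (n : ℕ) : Type := EuclideanSpace ℝ (Fin n)

/-- The `i`-th standard basis vector of `ℝⁿ`. -/
def stdVec {n : ℕ} (i : Fin n) : Euc n := EuclideanSpace.single i 1

/-! ### Sectional curvature of a Riemannian metric in coordinates -/

/-- The partial derivative `∂ᵢ h` at `u`. -/
def pderiv {n : ℕ} (i : Fin n) (h : Euc n → ℝ) (u : Euc n) : ℝ :=
  fderiv ℝ h u (stdVec i)

/-- The Christoffel symbol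
`Γᵏᵢⱼ = ½ ∑ₗ gᵏˡ (∂ᵢ gⱼₗ + ∂ⱼ gᵢₗ - ∂ₗ gᵢⱼ)` of the metric `g = (gᵢⱼ)`. -/
def christoffel {n : ℕ} (g : Euc n → Matrix (Fin n) (Fin n) ℝ) (k i j : Fin n)
    (u : Euc n) : ℝ :=
  (1 / 2 : ℝ) * ∑ l, (g u)⁻¹ k l *
    (pderiv i (fun v => g v j l) u + pderiv j (fun v => g v i l) u
      - pderiv l (fun v => g v i j) u)

/-- The components of the curvature tensor
`R(∂ᵢ, ∂ⱼ)∂ₖ = ∇ᵢ∇ⱼ∂ₖ - ∇ⱼ∇ᵢ∂ₖ = ∑ₗ Rˡₖᵢⱼ ∂ₗ` of the Levi-Civita connection of `g`. -/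
def riemann {n : ℕ} (g : Euc n → Matrix (Fin n) (Fin n) ℝ) (l k i j : Fin n)
    (u : Euc n) : ℝ :=
  pderiv i (christoffel g l j k) u - pderiv j (christoffel g l i k) u
    + ∑ a, (christoffel g l i a u * christoffel g a j k u
        - christoffel g l j a u * christoffel g a i k u)

/-- The inner product `g(X, Y)` at `u`. -/
def metricInner {n : ℕ} (g : Euc n → Matrix (Fin n) (Fin n) ℝ) (u X Y : Euc n) : ℝ :=
  ∑ i, ∑ j, g u i j * X i * Y j

/-- The sectional curvature
`K(X ∧ Y) = g(R(X, Y)Y, X) / (g(X, X) g(Y, Y) - g(X, Y)²)` of the metric `g` at `u`. -/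
def sectionalCurvature {n : ℕ} (g : Euc n → Matrix (Fin n) (Fin n) ℝ)
    (u X Y : Euc n) : ℝ :=
  (∑ i, ∑ j, ∑ k, ∑ l, ∑ s, g u l s * riemann g l k i j u * X i * Y j * Y k * X s) /
    (metricInner g u X X * metricInner g u Y Y - metricInner g u X Y ^ 2)

/-- The pull-back `F^*⟨ , ⟩` of the Euclidean metric by `F : ℝⁿ → ℝᴺ`. -/
def pullbackMetric {n N : ℕ} (F : Euc n → Euc N) (u : Euc n) : Matrix (Fin n) (Fin n) ℝ :=
  Matrix.of fun i j => inner ℝ (fderiv ℝ F u (stdVec i)) (fderiv ℝ F u (stdVec j))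

/-! ### Submanifolds and the curvature of the induced metric -/

section Manifold

variable {m : ℕ} {M : Type*} [TopologicalSpace M] [ChartedSpace (Euc m) M]

/-- `γ : W → S` is a local parametrization of the subset `S` of `M` as a `k`-dimensional smooth
submanifold: `W ⊆ ℝᵏ` is open, `γ` is a smooth immersion on `W`, and it is a homeomorphism of
`W` onto a relatively open subset of `S`. -/
structure IsLocalParam (m : ℕ) {M : Type*} [TopologicalSpace M] [ChartedSpace (Euc m) M]
    (k : ℕ) (S : Set M) (W : Set (Euc k)) (γ : Euc k → M) : Prop where
  isOpen : IsOpen W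
  smooth : ContMDiffOn (𝓡 k) (𝓡 m) ∞ γ W
  immersion : ∀ w ∈ W, Function.Injective (mfderiv (𝓡 k) (𝓡 m) γ w)
  embedding : Topology.IsEmbedding (W.domRestrict γ)
  image : ∃ O : Set M, IsOpen O ∧ γ '' W = S ∩ O

/-- `S` is a `k`-dimensional smooth (embedded) submanifold of `M`. -/
def IsSubmanifold (m : ℕ) {M : Type*} [TopologicalSpace M] [ChartedSpace (Euc m) M]
    (k : ℕ) (S : Set M) : Prop :=
  ∀ p ∈ S, ∃ (W : Set (Euc k)) (γ : Euc k → M), IsLocalParam m k S W γ ∧ p ∈ γ '' W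

/-- The metric induced by `f : M → ℝᵐ⁺¹` on the `k`-dimensional submanifold `S` of `M` is positive
definite, that is, the restriction of `f` to `S` is an immersion. -/
def InducedMetricPosDef (f : M → Euc (m + 1)) (k : ℕ) (S : Set M) : Prop :=
  ∀ (W : Set (Euc k)) (γ : Euc k → M), IsLocalParam m k S W γ → ∀ w ∈ W,
    Function.Injective (fderiv ℝ (f ∘ γ) w)

/-- Every value of the sectional curvature of the metric induced by `f : M → ℝᵐ⁺¹` on the
`k`-dimensional submanifold `S` of `M` satisfies `P`. -/
def SectionalCurvatureOn (f : M → Euc (m + 1)) (k : ℕ) (S : Set M) (P : ℝ → Prop) : Prop :=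
  ∀ (W : Set (Euc k)) (γ : Euc k → M), IsLocalParam m k S W γ → ∀ w ∈ W, ∀ X Y : Euc k,
    LinearIndependent ℝ ![X, Y] → P (sectionalCurvature (pullbackMetric (f ∘ γ)) w X Y)

/-! ### Fronts and their singular points -/

/-- `ν` is a smooth unit normal vector field along `f` on `U`. -/
structure IsUnitNormal (f ν : M → Euc (m + 1)) (U : Set M) : Prop where
  smooth : ContMDiffOn (𝓡 m) (𝓡 (m + 1)) ∞ ν U
  unit : ∀ x ∈ U, ‖ν x‖ = 1
  normal : ∀ x ∈ U, ∀ X : TangentSpace (𝓡 m) x,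
    inner (E := Euc (m + 1)) ℝ (mfderiv (𝓡 m) (𝓡 (m + 1)) f x X) (ν x) = 0

/-- `f : Mᵐ → ℝᵐ⁺¹` is a (wave) front: it is smooth, and locally it has a unit normal vector
field `ν` for which `(f, ν)`, as a map into the unit tangent bundle
`T₁ℝᵐ⁺¹ = ℝᵐ⁺¹ × Sᵐ ⊆ ℝᵐ⁺¹ × ℝᵐ⁺¹`, is an immersion. -/
def IsFront (f : M → Euc (m + 1)) : Prop :=
  ContMDiff (𝓡 m) (𝓡 (m + 1)) ∞ f ∧
  ∀ p : M, ∃ (U : Set M) (ν : M → Euc (m + 1)), IsOpen U ∧ p ∈ U ∧ IsUnitNormal f ν U ∧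
    ∀ x ∈ U, Function.Injective
      (mfderiv (𝓡 m) 𝓘(ℝ, Euc (m + 1) × Euc (m + 1)) (fun y => (f y, ν y)) x)

/-- The singular set of `f`: the points where `df` is not injective. -/
def singularSet (f : M → Euc (m + 1)) : Set M :=
  {p | ¬ Function.Injective (mfderiv (𝓡 m) (𝓡 (m + 1)) f p)}

/-- The Jacobian function `λ = det(∂₁f, …, ∂ₘf, ν)` in the coordinates of the chart at `p`. -/
def jacobianFunction (f ν : M → Euc (m + 1)) (p : M) (u : Euc m) : ℝ :=
  Matrix.det (Matrix.of fun i j : Fin (m + 1) =>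
    (Fin.snoc (α := fun _ => Euc (m + 1))
      (fun a : Fin m => fderiv ℝ (f ∘ (extChartAt (𝓡 m) p).symm) u (stdVec a))
      (ν ((extChartAt (𝓡 m) p).symm u)) i) j)

/-- The singular point `p` is non-degenerate: `dλ ≠ 0` at `p`. -/
def IsNonDegenerate (f : M → Euc (m + 1)) (p : M) : Prop :=
  p ∈ singularSet f ∧
  ∃ (U : Set M) (ν : M → Euc (m + 1)), IsOpen U ∧ p ∈ U ∧ IsUnitNormal f ν U ∧
    fderiv ℝ (jacobianFunction f ν p) (extChartAt (𝓡 m) p p) ≠ 0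

/-- `p` is an `A₂`-point of `f`: a non-degenerate singular point (near which, therefore, the
singular set is an `(m-1)`-dimensional submanifold) at which the null direction `ker df` is
transversal to the singular submanifold. -/
def IsA2Point (f : M → Euc (m + 1)) (p : M) : Prop :=
  IsNonDegenerate f p ∧
  ∀ (W : Set (Euc (m - 1))) (γ : Euc (m - 1) → M), IsLocalParam m (m - 1) (singularSet f) W γ →
    ∀ w ∈ W, γ w = p →
      IsCompl (LinearMap.ker (mfderiv (𝓡 m) (𝓡 (m + 1)) f (γ w)).toLinearMap)
        (LinearMap.range (mfderiv (𝓡 (m - 1)) (𝓡 m) γ w).toLinearMap)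

/-- `η` is a smooth vector field on `O` whose restriction to the singular set is a
(non-vanishing) null vector field. -/
structure IsExtendedNullField [IsManifold (𝓡 m) ∞ M] (f : M → Euc (m + 1)) (O : Set M)
    (η : ∀ x : M, TangentSpace (𝓡 m) x) : Prop where
  smooth : ContMDiffOn (𝓡 m) (𝓡 m).tangent ∞
    (fun x => (⟨x, η x⟩ : TangentBundle (𝓡 m) M)) O
  ne_zero : ∀ x ∈ O ∩ singularSet f, η x ≠ 0
  null : ∀ x ∈ O ∩ singularSet f, mfderiv (𝓡 m) (𝓡 (m + 1)) f x (η x) = 0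

/-- At the regular points in `O`, the sectional curvature of the induced metric is at least `δ`
on every tangent plane that contains `η`.  (`Z` is the coordinate expression of `η`.) -/
def NullCurvatureGE (f : M → Euc (m + 1)) (O : Set M)
    (η : ∀ x : M, TangentSpace (𝓡 m) x) (δ : ℝ) : Prop :=
  ∀ (W : Set (Euc m)) (γ : Euc m → M), IsLocalParam m m (singularSet f)ᶜ W γ →
    ∀ w ∈ W, γ w ∈ O → ∀ X Z : Euc m, mfderiv (𝓡 m) (𝓡 m) γ w Z = η (γ w) →
      LinearIndependent ℝ ![X, Z] →
        δ ≤ sectionalCurvature (pullbackMetric (f ∘ γ)) w X Z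

end Manifold

end WaveFront

end

open WaveFront

namespace WaveFront

open Filter Topology

/-! ### Smoothness of determinants and inverse matrices -/

/-! Near a singular point take coordinates (x, t) in which the singular set Σ is t = 0 and ∂ₜ is
null along Σ. Let F be the front in these coordinates, ν its normal, h its second fundamental form,
n = ∂ₜν at the point and a = ⟨F_tt, n⟩. For Z along the t-axis with Z = ∂ₜ at the point, the Gauss
equation turns K(X ∧ Z) ≥ δ into δ · Gram(F_X, F_Z) ≤ h(X, X) h(Z, Z), once the square h(X, Z)² is
dropped. Since F_Z vanishes to first order at t = 0, the Gram determinant is asymptotic to Q t² with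
Q > 0, while h(Z, Z) has a simple zero with derivative -a. So h(Z, Z) changes sign, which forces
h(X, X) = 0 at the point, and the coefficients of t² give δ Q ≤ -a ⟨F_XX, n⟩. This is
`second_fundamental_form_of_curvature_ge`, with the limit in `eq_zero_and_le_of_mul_ge`.

As a submanifold of Euclidean space, Σ has codimension two, and its normal plane is spanned by ν and
n. The ν-component of its second fundamental form is h, which vanishes; the n-component times -a is
positive semi-definite, and definite if δ > 0. By the Gauss equation of Σ its sectional curvature is
a 2 × 2 determinant of this form over a positive number (`singular_curvature_of_curvature_ge`).

Two non-vanishing facts are needed. First, n ≠ 0, because F_t = 0 while (f, ν) is an immersion.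
Second, a ≠ 0: λ vanishes on Σ and the null direction η is transversal to Σ, so dλ(η) ≠ 0, and a
column of the adjugate of the Jacobian matrix is a vector c normal to the image of df with ⟨F_tt, c⟩
≠ 0 (`exists_normal_of_fderiv_jacobianFunction_ne_zero`). If a were 0, F_tt would be orthogonal to ν
and n, hence tangent, hence orthogonal to c.

That Σ is a submanifold is the inverse function theorem applied to λ, and that f restricts to an
immersion of Σ is transversality. -/

lemma contDiffAt_matrix_det {E ι : Type*} [NormedAddCommGroup E] [NormedSpace ℝ E]
    [Fintype ι] [DecidableEq ι] {n : WithTop ℕ∞} {A : E → Matrix ι ι ℝ} {u : E}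
    (hA : ∀ i j, ContDiffAt ℝ n (fun v => A v i j) u) :
    ContDiffAt ℝ n (fun v => (A v).det) u := by
  simp only [Matrix.det_apply]
  refine ContDiffAt.sum fun σ _ => ?_
  simp only [Units.smul_def, zsmul_eq_mul]
  exact contDiffAt_const.mul (contDiffAt_prod fun i _ => hA _ _)

lemma contDiffAt_matrix_adjugate {E ι : Type*} [NormedAddCommGroup E] [NormedSpace ℝ E]
    [Fintype ι] [DecidableEq ι] {n : WithTop ℕ∞} {A : E → Matrix ι ι ℝ} {u : E}
    (hA : ∀ i j, ContDiffAt ℝ n (fun v => A v i j) u) (i j : ι) :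
    ContDiffAt ℝ n (fun v => (A v).adjugate i j) u := by
  simp only [Matrix.adjugate_apply]
  refine contDiffAt_matrix_det fun a b => ?_
  by_cases h : a = j
  · subst h
    simp only [Matrix.updateRow_self]
    exact contDiffAt_const
  · simp only [Matrix.updateRow_ne h]
    exact hA a b

lemma contDiffAt_matrix_inv {E ι : Type*} [NormedAddCommGroup E] [NormedSpace ℝ E]
    [Fintype ι] [DecidableEq ι] {n : WithTop ℕ∞} {A : E → Matrix ι ι ℝ} {u : E}
    (hA : ∀ i j, ContDiffAt ℝ n (fun v => A v i j) u) (hu : (A u).det ≠ 0) (i j : ι) :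
    ContDiffAt ℝ n (fun v => (A v)⁻¹ i j) u := by
  simp only [Matrix.inv_def, Ring.inverse_eq_inv', Matrix.smul_apply, smul_eq_mul]
  exact ((contDiffAt_matrix_det hA).inv hu).mul (contDiffAt_matrix_adjugate hA i j)

/-! ### The Gauss equation -/

section Gauss

variable {n N : ℕ} {F : Euc n → Euc N} {u : Euc n}

lemma sum_smul_stdVec (X : Euc n) : ∑ i, X i • stdVec i = X := by
  have := (EuclideanSpace.basisFun (Fin n) ℝ).sum_repr X
  simpa [stdVec] using this

lemma map_eq_sum {V : Type*} [AddCommGroup V] [Module ℝ V] [TopologicalSpace V]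
    (L : Euc n →L[ℝ] V) (X : Euc n) : L X = ∑ i, X i • L (stdVec i) := by
  conv_lhs => rw [← sum_smul_stdVec X]
  simp

lemma metricInner_pullbackMetric (F : Euc n → Euc N) (u X Y : Euc n) :
    metricInner (pullbackMetric F) u X Y = inner ℝ (fderiv ℝ F u X) (fderiv ℝ F u Y) := by
  rw [map_eq_sum (fderiv ℝ F u) X, map_eq_sum (fderiv ℝ F u) Y, sum_inner]
  refine Finset.sum_congr rfl fun i _ => ?_
  rw [inner_sum]
  refine Finset.sum_congr rfl fun j _ => ?_
  simp only [pullbackMetric, Matrix.of_apply, inner_smul_left, inner_smul_right]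
  simp
  ring

lemma differentiableAt_fderiv_apply (hF : ContDiffAt ℝ 2 F u) (X : Euc n) :
    DifferentiableAt ℝ (fun v => fderiv ℝ F v X) u :=
  ((hF.fderiv_right (m := 1) (by norm_num)).differentiableAt (by norm_num)).clm_apply
    (differentiableAt_const X)

lemma fderiv_fderiv_apply (hF : ContDiffAt ℝ 2 F u) (X Y : Euc n) :
    fderiv ℝ (fun v => fderiv ℝ F v X) u Y = fderiv ℝ (fderiv ℝ F) u Y X := by
  have h := (hF.fderiv_right (m := 1) (by norm_num)).differentiableAt (by norm_num)
  rw [fderiv_clm_apply h (differentiableAt_const X)]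
  simp

lemma fderiv_fderiv_comm (hF : ContDiffAt ℝ 2 F u) (X Y : Euc n) :
    fderiv ℝ (fderiv ℝ F) u X Y = fderiv ℝ (fderiv ℝ F) u Y X :=
  hF.isSymmSndFDerivAt (by simp) X Y

lemma pderiv_pullbackMetric (hF : ContDiffAt ℝ 2 F u) (a i j : Fin n) :
    pderiv a (fun v => pullbackMetric F v i j) u =
      inner ℝ (fderiv ℝ F u (stdVec i)) (fderiv ℝ (fderiv ℝ F) u (stdVec a) (stdVec j)) +
      inner ℝ (fderiv ℝ (fderiv ℝ F) u (stdVec a) (stdVec i)) (fderiv ℝ F u (stdVec j)) := by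
  simp only [pderiv, pullbackMetric, Matrix.of_apply]
  rw [fderiv_inner_apply ℝ (differentiableAt_fderiv_apply hF _)
    (differentiableAt_fderiv_apply hF _), fderiv_fderiv_apply hF, fderiv_fderiv_apply hF]

/-- Among the six terms of the three partial derivatives, symmetry of second derivatives cancels
four and leaves `⟨∂ᵢ∂ⱼF, ∂ₗF⟩` twice, against the factor ½. -/
lemma christoffel_pullbackMetric (hF : ContDiffAt ℝ 2 F u) (k i j : Fin n) :
    christoffel (pullbackMetric F) k i j u = ∑ l, (pullbackMetric F u)⁻¹ k l *
      inner ℝ (fderiv ℝ (fderiv ℝ F) u (stdVec i) (stdVec j)) (fderiv ℝ F u (stdVec l)) := by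
  rw [christoffel, Finset.mul_sum]
  refine Finset.sum_congr rfl fun l _ => ?_
  rw [pderiv_pullbackMetric hF, pderiv_pullbackMetric hF, pderiv_pullbackMetric hF,
    fderiv_fderiv_comm hF (stdVec j) (stdVec i), fderiv_fderiv_comm hF (stdVec l) (stdVec i),
    fderiv_fderiv_comm hF (stdVec l) (stdVec j),
    real_inner_comm (fderiv ℝ (fderiv ℝ F) u (stdVec i) (stdVec l)) (fderiv ℝ F u (stdVec j))]
  ring

/-- A vector in the kernel of the Gram matrix has an image of length zero under the derivative. -/
lemma det_pullbackMetric_ne_zero (hinj : Function.Injective (fderiv ℝ F u)) :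
    (pullbackMetric F u).det ≠ 0 := by
  intro h
  obtain ⟨x, hx, h0⟩ := Matrix.exists_mulVec_eq_zero_iff.2 h
  apply hx
  have h1 : metricInner (pullbackMetric F) u (WithLp.toLp 2 x) (WithLp.toLp 2 x) = 0 := by
    rw [metricInner]
    refine Finset.sum_eq_zero fun i _ => ?_
    have := congrFun h0 i
    simp only [Matrix.mulVec, dotProduct, Pi.zero_apply] at this
    calc _ = x i * ∑ j, pullbackMetric F u i j * x j := by
          rw [Finset.mul_sum]; refine Finset.sum_congr rfl fun j _ => ?_
          simp; ring
      _ = 0 := by rw [this, mul_zero]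
  rw [metricInner_pullbackMetric, inner_self_eq_zero] at h1
  have h2 := hinj (h1.trans (map_zero _).symm)
  simpa using congrArg (WithLp.ofLp) h2

lemma contDiffAt_pullbackMetric {r : WithTop ℕ∞} (hF : ContDiffAt ℝ (r + 1) F u) (i j : Fin n) :
    ContDiffAt ℝ r (fun v => pullbackMetric F v i j) u := by
  have h := hF.fderiv_right (m := r) le_rfl
  simp only [pullbackMetric, Matrix.of_apply]
  exact (h.clm_apply contDiffAt_const).inner ℝ (h.clm_apply contDiffAt_const)

/-- Contracting with the metric undoes its inverse in the Christoffel formula. Thus `∑ₗ Γˡᵢⱼ ∂ₗF` is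
the tangential part of `∂ᵢ∂ⱼF`, on which the Gauss equation rests. -/
lemma sum_christoffel_mul (hF : ContDiffAt ℝ 2 F u) (hg : (pullbackMetric F u).det ≠ 0)
    (i j s : Fin n) :
    ∑ l, christoffel (pullbackMetric F) l i j u * pullbackMetric F u l s =
      inner ℝ (fderiv ℝ (fderiv ℝ F) u (stdVec i) (stdVec j)) (fderiv ℝ F u (stdVec s)) := by
  have hsymm : ∀ a b, pullbackMetric F u a b = pullbackMetric F u b a := fun a b => by
    simp only [pullbackMetric, Matrix.of_apply]; exact real_inner_comm _ _
  have hinv : pullbackMetric F u * (pullbackMetric F u)⁻¹ = 1 :=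
    Matrix.mul_nonsing_inv _ (isUnit_iff_ne_zero.2 hg)
  simp only [christoffel_pullbackMetric hF, Finset.sum_mul]
  rw [Finset.sum_comm]
  have : ∀ a, ∑ l, pullbackMetric F u s l * (pullbackMetric F u)⁻¹ l a = if s = a then 1 else 0 := by
    intro a
    have := congrFun (congrFun hinv s) a
    rwa [Matrix.mul_apply, Matrix.one_apply] at this
  calc _ = ∑ a, (∑ l, pullbackMetric F u s l * (pullbackMetric F u)⁻¹ l a) *
        inner ℝ (fderiv ℝ (fderiv ℝ F) u (stdVec i) (stdVec j)) (fderiv ℝ F u (stdVec a)) := by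
        refine Finset.sum_congr rfl fun a _ => ?_
        rw [Finset.sum_mul]
        refine Finset.sum_congr rfl fun l _ => ?_
        rw [hsymm l s]; ring
    _ = _ := by simp [this]

lemma differentiableAt_christoffel (hF : ContDiffAt ℝ 3 F u) (hg : (pullbackMetric F u).det ≠ 0)
    (k i j : Fin n) : DifferentiableAt ℝ (christoffel (pullbackMetric F) k i j) u := by
  have h2 : ContDiffAt ℝ (1 + 1 + 1) F u := hF.of_le (by norm_num)
  have heq : christoffel (pullbackMetric F) k i j =ᶠ[𝓝 u] fun v =>
      ∑ l, (pullbackMetric F v)⁻¹ k l *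
        inner ℝ (fderiv ℝ (fderiv ℝ F) v (stdVec i) (stdVec j)) (fderiv ℝ F v (stdVec l)) := by
    filter_upwards [(hF.of_le (m := 2) (by norm_num)).eventually (by simp)] with v hv
    exact christoffel_pullbackMetric hv k i j
  refine DifferentiableAt.congr_of_eventuallyEq ?_ heq
  have h3 := h2.fderiv_right (m := 1 + 1) le_rfl
  have h4 := h3.fderiv_right (m := 1) le_rfl
  refine ContDiffAt.differentiableAt (n := 1) (ContDiffAt.sum fun l _ => ?_) (by norm_num)
  refine ContDiffAt.mul ?_ ?_
  · exact contDiffAt_matrix_inv (fun a b => contDiffAt_pullbackMetric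
      (hF.of_le (by norm_num)) a b) hg k l
  · exact ((h4.clm_apply contDiffAt_const).clm_apply contDiffAt_const).inner ℝ
      ((h3.of_le (by norm_num)).clm_apply contDiffAt_const)

/-- The Gauss equation for the components of the curvature tensor. -/
lemma sum_metric_mul_riemann (hF : ContDiffAt ℝ 3 F u) (hg : (pullbackMetric F u).det ≠ 0)
    (k i j s : Fin n) :
    ∑ l, pullbackMetric F u l s * riemann (pullbackMetric F) l k i j u =
      inner ℝ (fderiv ℝ (fderiv ℝ F) u (stdVec j) (stdVec k) -
          ∑ l, christoffel (pullbackMetric F) l j k u • fderiv ℝ F u (stdVec l))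
        (fderiv ℝ (fderiv ℝ F) u (stdVec i) (stdVec s)) -
      inner ℝ (fderiv ℝ (fderiv ℝ F) u (stdVec i) (stdVec k) -
          ∑ l, christoffel (pullbackMetric F) l i k u • fderiv ℝ F u (stdVec l))
        (fderiv ℝ (fderiv ℝ F) u (stdVec j) (stdVec s)) := by
  have hF2 : ContDiffAt ℝ 2 F u := hF.of_le (by norm_num)
  have hgd : ∀ a b, DifferentiableAt ℝ (fun v => pullbackMetric F v a b) u := fun a b =>
    (contDiffAt_pullbackMetric (r := 1) (hF.of_le (by norm_num)) a b).differentiableAt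
      (by norm_num)
  have hgev : ∀ᶠ v in 𝓝 u, (pullbackMetric F v).det ≠ 0 :=
    (contDiffAt_matrix_det (n := 1) fun a b => contDiffAt_pullbackMetric (r := 1)
      (hF.of_le (by norm_num)) a b).continuousAt.eventually_ne hg
  have hd2 : DifferentiableAt ℝ (fderiv ℝ (fderiv ℝ F)) u :=
    ((hF.fderiv_right (m := 2) (by norm_num)).fderiv_right (m := 1) (by norm_num)).differentiableAt
      (by norm_num)
  -- Differentiate `⟨∂ⱼ∂ₖF, ∂ₛF⟩ = ∑ₗ Γˡⱼₖ gₗₛ`, valid near `u`, in the direction `i`.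
  -- Antisymmetrizing in `i, j` will cancel the third derivatives of `F`.
  have key : ∀ i j, inner ℝ (fderiv ℝ (fderiv ℝ F) u (stdVec j) (stdVec k))
        (fderiv ℝ (fderiv ℝ F) u (stdVec i) (stdVec s)) +
      inner ℝ (fderiv ℝ (fderiv ℝ (fderiv ℝ F)) u (stdVec i) (stdVec j) (stdVec k))
        (fderiv ℝ F u (stdVec s)) =
      ∑ l, (christoffel (pullbackMetric F) l j k u *
        (inner ℝ (fderiv ℝ F u (stdVec l)) (fderiv ℝ (fderiv ℝ F) u (stdVec i) (stdVec s)) +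
          inner ℝ (fderiv ℝ (fderiv ℝ F) u (stdVec i) (stdVec l)) (fderiv ℝ F u (stdVec s))) +
        pderiv i (christoffel (pullbackMetric F) l j k) u * pullbackMetric F u l s) := by
    intro i j
    have heq : (fun v => inner ℝ (fderiv ℝ (fderiv ℝ F) v (stdVec j) (stdVec k))
        (fderiv ℝ F v (stdVec s))) =ᶠ[𝓝 u]
        fun v => ∑ l, christoffel (pullbackMetric F) l j k v * pullbackMetric F v l s := by
      filter_upwards [hF2.eventually (by simp), hgev] with v hv hgv
      exact (sum_christoffel_mul hv hgv j k s).symm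
    have h := congrArg (fun L : Euc n →L[ℝ] ℝ => L (stdVec i)) heq.fderiv_eq
    rw [fderiv_inner_apply ℝ ((hd2.clm_apply (differentiableAt_const _)).clm_apply
      (differentiableAt_const _)) (differentiableAt_fderiv_apply hF2 _),
      fderiv_fderiv_apply hF2, fderiv_fun_sum (fun l _ =>
        (differentiableAt_christoffel hF hg _ _ _).fun_mul (hgd _ _))] at h
    rw [fderiv_clm_apply (hd2.clm_apply (differentiableAt_const _)) (differentiableAt_const _),
      fderiv_clm_apply hd2 (differentiableAt_const _)] at h
    simp only [fderiv_fun_const, Pi.zero_apply, ContinuousLinearMap.comp_zero, zero_add,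
      ContinuousLinearMap.flip_apply] at h
    rw [h, sum_apply]
    refine Finset.sum_congr rfl fun l _ => ?_
    rw [fderiv_fun_mul (differentiableAt_christoffel hF hg _ _ _) (hgd _ _)]
    have hp := pderiv_pullbackMetric hF2 i l s
    rw [pderiv] at hp
    simp only [add_apply, smul_apply, smul_eq_mul, hp,
      pderiv]
    ring
  have hsymm3 : fderiv ℝ (fderiv ℝ (fderiv ℝ F)) u (stdVec i) (stdVec j) (stdVec k) =
      fderiv ℝ (fderiv ℝ (fderiv ℝ F)) u (stdVec j) (stdVec i) (stdVec k) := by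
    rw [((hF.fderiv_right (m := 2) (by norm_num)).isSymmSndFDerivAt (by simp)) (stdVec i)
      (stdVec j)]
  -- The quadratic Christoffel terms of the curvature, lowered by the metric, are the terms `Γ
  -- ⟨∂ᵢ∂ₗF, ∂ₛF⟩` of `key`.
  have hquad : ∀ i j, ∑ l, pullbackMetric F u l s * ∑ a, christoffel (pullbackMetric F) l i a u *
      christoffel (pullbackMetric F) a j k u = ∑ l, christoffel (pullbackMetric F) l j k u *
      inner ℝ (fderiv ℝ (fderiv ℝ F) u (stdVec i) (stdVec l)) (fderiv ℝ F u (stdVec s)) := by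
    intro i j
    simp only [← sum_christoffel_mul hF2 hg, Finset.mul_sum]
    rw [Finset.sum_comm]
    refine Finset.sum_congr rfl fun a _ => Finset.sum_congr rfl fun l _ => ?_
    ring
  have h1 := key i j
  have h2 := key j i
  have h3 := hquad i j
  have h4 := hquad j i
  simp only [Finset.sum_add_distrib, mul_add] at h1 h2
  simp only [riemann, Finset.sum_sub_distrib, Finset.sum_add_distrib, mul_add, mul_sub,
    inner_sub_left, sum_inner, inner_smul_left, h3, h4]
  rw [hsymm3] at h1
  simp only [mul_comm (pullbackMetric F u _ s)]
  simp only [conj_trivial]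
  linarith

/-- The **Gauss equation**: if `II X Y` is the component of the second derivative of `F`
normal to `F`, the sectional curvature of the induced metric is
`(⟨II X X, II Y Y⟩ - ‖II X Y‖²) / (‖X‖² ‖Y‖² - ⟨X, Y⟩²)`. -/
theorem sectionalCurvature_pullbackMetric (hF : ContDiffAt ℝ 3 F u)
    (hinj : Function.Injective (fderiv ℝ F u)) (II : Euc n → Euc n → Euc N)
    (hperp : ∀ X Y V, inner ℝ (II X Y) (fderiv ℝ F u V) = 0)
    (htan : ∀ X Y, ∃ V, fderiv ℝ (fderiv ℝ F) u X Y - II X Y = fderiv ℝ F u V) (X Y : Euc n) :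
    sectionalCurvature (pullbackMetric F) u X Y =
      (inner ℝ (II X X) (II Y Y) - inner ℝ (II X Y) (II X Y)) /
      (inner ℝ (fderiv ℝ F u X) (fderiv ℝ F u X) * inner ℝ (fderiv ℝ F u Y) (fderiv ℝ F u Y) -
        inner ℝ (fderiv ℝ F u X) (fderiv ℝ F u Y) ^ 2) := by
  have hg := det_pullbackMetric_ne_zero hinj
  have hF2 : ContDiffAt ℝ 2 F u := hF.of_le (by norm_num)
  rw [sectionalCurvature, metricInner_pullbackMetric, metricInner_pullbackMetric,
    metricInner_pullbackMetric]
  congr 1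
  -- The normal part of the second derivative as given by the Christoffel symbols; `hII` identifies
  -- it with the prescribed `II`.
  set T : Fin n → Fin n → Euc N := fun j k => fderiv ℝ (fderiv ℝ F) u (stdVec j) (stdVec k) -
          ∑ l, christoffel (pullbackMetric F) l j k u • fderiv ℝ F u (stdVec l) with hT
  have hTperp : ∀ j k V, inner ℝ (T j k) (fderiv ℝ F u V) = 0 := by
    intro j k V
    rw [map_eq_sum, inner_sum]
    refine Finset.sum_eq_zero fun s _ => ?_
    rw [inner_smul_right, hT, inner_sub_left, sum_inner, ← sum_christoffel_mul hF2 hg]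
    simp [inner_smul_left, pullbackMetric]
  have hD : ∀ X Y, fderiv ℝ (fderiv ℝ F) u X Y =
      ∑ i, ∑ j, (X i * Y j) • fderiv ℝ (fderiv ℝ F) u (stdVec i) (stdVec j) := by
    intro X Y
    rw [map_eq_sum (fderiv ℝ (fderiv ℝ F) u) X, sum_apply]
    refine Finset.sum_congr rfl fun i _ => ?_
    rw [smul_apply, map_eq_sum _ Y, Finset.smul_sum]
    simp [mul_smul]
  have hII : ∀ X Y, II X Y = ∑ i, ∑ j, (X i * Y j) • T i j := by
    intro X Y
    obtain ⟨V, hV⟩ := htan X Y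
    have : ∃ V', II X Y - ∑ i, ∑ j, (X i * Y j) • T i j = fderiv ℝ F u V' := by
      refine ⟨-V + ∑ i, ∑ j, (X i * Y j) • ∑ l, christoffel (pullbackMetric F) l i j u •
        stdVec l, ?_⟩
      rw [map_add, map_neg, ← hV, hD]
      simp only [map_sum, map_smul, hT, smul_sub, Finset.sum_sub_distrib]
      abel
    obtain ⟨V', hV'⟩ := this
    -- The difference is tangent by `hV'` and normal by `hperp` and `hTperp`, so it is orthogonal to
    -- itself.
    rw [← sub_eq_zero, ← inner_self_eq_zero (𝕜 := ℝ)]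
    nth_rewrite 2 [hV']
    rw [inner_sub_left, hperp, sum_inner]
    simp [sum_inner, inner_smul_left, hTperp]
  -- In one factor `II` may be replaced by the full second derivative, whose tangential part is
  -- orthogonal to the other factor.
  have hswap : ∀ A B C D, inner ℝ (II A B) (II C D) =
      inner ℝ (II A B) (fderiv ℝ (fderiv ℝ F) u C D) := by
    intro A B C D
    obtain ⟨V, hV⟩ := htan C D
    rw [sub_eq_iff_eq_add.1 hV, inner_add_right, hperp, zero_add]
  have hsym : II X Y = II Y X := by
    obtain ⟨V, hV⟩ := htan X Y
    obtain ⟨V', hV'⟩ := htan Y X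
    rw [← sub_eq_zero, ← inner_self_eq_zero (𝕜 := ℝ)]
    have : II X Y - II Y X = fderiv ℝ F u (V' - V) := by
      rw [map_sub, ← hV, ← hV', fderiv_fderiv_comm hF2 X Y]; abel
    nth_rewrite 2 [this]
    rw [inner_sub_left, hperp, hperp, sub_zero]
  have h1 : ∀ i j k, ∑ l, ∑ s, pullbackMetric F u l s * riemann (pullbackMetric F) l k i j u *
      X i * Y j * Y k * X s = ∑ s, (inner ℝ (T j k) (fderiv ℝ (fderiv ℝ F) u (stdVec i) (stdVec s))
        - inner ℝ (T i k) (fderiv ℝ (fderiv ℝ F) u (stdVec j) (stdVec s))) *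
          (X i * Y j * Y k * X s) := by
    intro i j k
    rw [Finset.sum_comm]
    refine Finset.sum_congr rfl fun s _ => ?_
    rw [← sum_metric_mul_riemann hF hg, Finset.sum_mul]
    refine Finset.sum_congr rfl fun l _ => ?_
    ring
  have h2 : inner ℝ (II X X) (II Y Y) = ∑ i, ∑ j, ∑ k, ∑ s,
      inner ℝ (T j k) (fderiv ℝ (fderiv ℝ F) u (stdVec i) (stdVec s)) *
        (X i * Y j * Y k * X s) := by
    rw [real_inner_comm, hswap, hII, hD, inner_sum]
    refine Finset.sum_congr rfl fun i _ => ?_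
    rw [sum_inner]
    refine Finset.sum_congr rfl fun j _ => ?_
    rw [sum_inner]
    refine Finset.sum_congr rfl fun k _ => ?_
    rw [inner_sum]
    refine Finset.sum_congr rfl fun s _ => ?_
    rw [inner_smul_left, inner_smul_right]
    simp only [conj_trivial]
    ring
  have h3 : inner ℝ (II X Y) (II X Y) = ∑ i, ∑ j, ∑ k, ∑ s,
      inner ℝ (T i k) (fderiv ℝ (fderiv ℝ F) u (stdVec j) (stdVec s)) *
        (X i * Y j * Y k * X s) := by
    nth_rewrite 2 [hsym]
    rw [hswap, hII, hD, sum_inner]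
    refine Finset.sum_congr rfl fun i _ => ?_
    rw [inner_sum]
    refine Finset.sum_congr rfl fun j _ => ?_
    rw [sum_inner]
    refine Finset.sum_congr rfl fun k _ => ?_
    rw [inner_sum]
    refine Finset.sum_congr rfl fun s _ => ?_
    rw [inner_smul_left, inner_smul_right]
    simp only [conj_trivial]
    ring
  rw [h2, h3, ← Finset.sum_sub_distrib]
  refine Finset.sum_congr rfl fun i _ => ?_
  rw [← Finset.sum_sub_distrib]
  refine Finset.sum_congr rfl fun j _ => ?_
  rw [← Finset.sum_sub_distrib]
  refine Finset.sum_congr rfl fun k _ => ?_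
  rw [h1, ← Finset.sum_sub_distrib]
  refine Finset.sum_congr rfl fun s _ => ?_
  ring

/-- The curvature at a point is built from derivatives of the metric there, so it depends only on
the germ. -/
lemma sectionalCurvature_congr {g g' : Euc n → Matrix (Fin n) (Fin n) ℝ}
    (h : g =ᶠ[𝓝 u] g') (X Y : Euc n) :
    sectionalCurvature g u X Y = sectionalCurvature g' u X Y := by
  have hp : ∀ v, g =ᶠ[𝓝 v] g' → ∀ a i j, pderiv a (fun v => g v i j) v =
      pderiv a (fun v => g' v i j) v := by
    intro v hv a i j
    have : (fun v => g v i j) =ᶠ[𝓝 v] fun v => g' v i j := by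
      filter_upwards [hv] with x hx
      rw [hx]
    rw [pderiv, this.fderiv_eq, pderiv]
  have hc : ∀ k i j, christoffel g k i j =ᶠ[𝓝 u] christoffel g' k i j := by
    intro k i j
    filter_upwards [h.eventuallyEq_nhds] with v hv
    simp only [christoffel, hp v hv, hv.eq_of_nhds]
  have hr : ∀ l k i j, riemann g l k i j u = riemann g' l k i j u := by
    intro l k i j
    simp only [riemann, pderiv, (hc _ _ _).fderiv_eq, (hc _ _ _).eq_of_nhds]
  simp only [sectionalCurvature, metricInner, hr, h.eq_of_nhds]

lemma pullbackMetric_congr {F G : Euc n → Euc N} (h : F =ᶠ[𝓝 u] G) :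
    pullbackMetric F =ᶠ[𝓝 u] pullbackMetric G := by
  filter_upwards [h.eventuallyEq_nhds] with v hv
  simp only [pullbackMetric, hv.fderiv_eq]

end Gauss

/-! ### The splitting `ℝᵏ⁺¹ = ℝᵏ × ℝ` -/

section Splitting

/-- The inclusion `ℝᵏ → ℝᵏ⁺¹`, `x ↦ (x, 0)`. -/
noncomputable def incl (k : ℕ) : Euc k →L[ℝ] Euc (k + 1) :=
  LinearMap.toContinuousLinearMap
    { toFun := fun x => WithLp.toLp 2 (Fin.snoc (α := fun _ => ℝ) x.ofLp 0)
      map_add' := fun x y => by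
        ext i; refine Fin.lastCases ?_ (fun j => ?_) i <;> simp
      map_smul' := fun c x => by
        ext i; refine Fin.lastCases ?_ (fun j => ?_) i <;> simp }

/-- The projection `ℝᵏ⁺¹ → ℝᵏ`, `(x, t) ↦ x`. -/
noncomputable def horiz (k : ℕ) : Euc (k + 1) →L[ℝ] Euc k :=
  LinearMap.toContinuousLinearMap
    { toFun := fun y => WithLp.toLp 2 (fun i => y i.castSucc)
      map_add' := fun x y => by ext i; simp
      map_smul' := fun c x => by ext i; simp }

/-- The projection `ℝᵏ⁺¹ → ℝ`, `(x, t) ↦ t`. -/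
noncomputable def height (k : ℕ) : Euc (k + 1) →L[ℝ] ℝ := EuclideanSpace.proj (Fin.last k)

/-- The last basis vector `(0, 1)` of `ℝᵏ⁺¹`. -/
noncomputable def vert (k : ℕ) : Euc (k + 1) := stdVec (Fin.last k)

variable {k : ℕ}

@[simp] lemma horiz_incl (x : Euc k) : horiz k (incl k x) = x := by
  ext i; simp [horiz, incl]

@[simp] lemma height_incl (x : Euc k) : height k (incl k x) = 0 := by
  simp [height, incl]

@[simp] lemma horiz_vert : horiz k (vert k) = 0 := by
  ext i; simp [horiz, vert, stdVec]

@[simp] lemma height_vert : height k (vert k) = 1 := by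
  simp [height, vert, stdVec]

lemma incl_horiz_add (y : Euc (k + 1)) :
    incl k (horiz k y) + height k y • vert k = y := by
  ext i
  refine Fin.lastCases ?_ (fun j => ?_) i
  · simp [horiz, incl, height, vert, stdVec]
  · simp [horiz, incl, height, vert, stdVec, (Fin.castSucc_lt_last j).ne]

lemma linearIndependent_incl {x : Euc k} (hx : x ≠ 0) {z : Euc (k + 1)} (hz : height k z ≠ 0) :
    LinearIndependent ℝ ![incl k x, z] := by
  rw [LinearIndependent.pair_iff]
  intro s t h
  have h1 := congrArg (height k) h
  simp only [map_add, map_smul, height_incl, smul_eq_mul, mul_zero, zero_add, map_zero,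
    mul_eq_zero, hz, or_false] at h1
  subst h1
  have h2 := congrArg (horiz k) h
  simp only [map_smul, horiz_incl, zero_smul, add_zero, map_zero, smul_eq_zero, hx,
    or_false] at h2
  exact ⟨h2, rfl⟩

end Splitting

/-! ### Linear algebra -/

/-- The discriminant of a quadratic in `s`: it turns semi-definiteness of a form on the vectors `X +
s • Y` into the sign of its 2 × 2 determinant. -/
lemma mul_sub_sq_nonneg_of_forall {a b c : ℝ} (h : ∀ s : ℝ, 0 ≤ c + 2 * s * b + s ^ 2 * a) :
    0 ≤ c * a - b ^ 2 := by
  have := discrim_le_zero (a := a) (b := 2 * b) (c := c) fun s => by linarith [h s]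
  rw [discrim] at this
  linarith

lemma mul_sub_sq_pos_of_forall {a b c : ℝ} (ha : 0 < a)
    (h : ∀ s : ℝ, 0 < c + 2 * s * b + s ^ 2 * a) : 0 < c * a - b ^ 2 := by
  have := discrim_lt_zero (a := a) (b := 2 * b) (c := c) ha.ne' fun s => by linarith [h s]
  rw [discrim] at this
  linarith

lemma add_smul_ne_zero_of_pair {E : Type*} [AddCommGroup E] [Module ℝ E] {X Y : E}
    (h : LinearIndependent ℝ ![X, Y]) (s : ℝ) : X + s • Y ≠ 0 := by
  intro h0
  have := (LinearIndependent.pair_iff.1 h) 1 s (by simpa using h0)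
  simp at this

lemma linearIndependent_pair_map {E E' : Type*} [AddCommGroup E] [Module ℝ E]
    [TopologicalSpace E] [AddCommGroup E'] [Module ℝ E'] [TopologicalSpace E'] {A : E →L[ℝ] E'}
    (hA : Function.Injective A) {X Y : E} (h : LinearIndependent ℝ ![X, Y]) :
    LinearIndependent ℝ ![A X, A Y] := by
  rw [LinearIndependent.pair_iff] at h ⊢
  intro s t hst
  refine h s t (hA ?_)
  simpa using hst

lemma gram_pos {E : Type*} [NormedAddCommGroup E] [InnerProductSpace ℝ E] {X Y : E}
    (h : LinearIndependent ℝ ![X, Y]) :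
    0 < inner ℝ X X * inner ℝ Y Y - inner ℝ X Y ^ 2 := by
  refine mul_sub_sq_pos_of_forall ?_ fun s => ?_
  · exact real_inner_self_pos.2 (by simpa using h.ne_zero 1)
  · have := real_inner_self_pos.2 (add_smul_ne_zero_of_pair h s)
    rw [inner_add_left, inner_add_right, inner_add_right, inner_smul_left, inner_smul_left,
      inner_smul_right, inner_smul_right, real_inner_comm X Y] at this
    simp only [conj_trivial] at this
    linarith

/-- A dimension count: the `r = N - n` independent vectors `w i` span the orthogonal complement of
the range, and the range is its own double orthogonal complement. -/
lemma mem_range_of_inner_eq_zero {n N r : ℕ} {A : Euc n →L[ℝ] Euc N}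
    (hA : Function.Injective A) {w : Fin r → Euc N} (hw : LinearIndependent ℝ w)
    (hr : n + r = N) (hperp : ∀ i x, inner ℝ (w i) (A x) = 0) {v : Euc N}
    (hv : ∀ i, inner ℝ (w i) v = 0) : ∃ x, v = A x := by
  have hle : Submodule.span ℝ (Set.range w) ≤ (LinearMap.range A.toLinearMap)ᗮ := by
    rw [Submodule.span_le]
    rintro _ ⟨i, rfl⟩
    rw [SetLike.mem_coe, Submodule.mem_orthogonal']
    rintro _ ⟨x, rfl⟩
    exact hperp i x
  have h1 : Module.finrank ℝ (LinearMap.range A.toLinearMap) = n := by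
    rw [LinearMap.finrank_range_of_inj hA, finrank_euclideanSpace_fin]
  have h2 := Submodule.finrank_add_finrank_orthogonal (LinearMap.range A.toLinearMap)
  rw [h1, finrank_euclideanSpace_fin] at h2
  have h3 : Module.finrank ℝ (Submodule.span ℝ (Set.range w)) = r := by
    rw [finrank_span_eq_card hw, Fintype.card_fin]
  have heq := Submodule.eq_of_le_of_finrank_eq hle (by omega)
  have hmem : v ∈ (LinearMap.range A.toLinearMap)ᗮᗮ := by
    rw [← heq, Submodule.mem_orthogonal]
    intro u hu
    induction hu using Submodule.span_induction with
    | mem x hx => obtain ⟨i, rfl⟩ := hx; exact hv i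
    | zero => simp
    | add x y _ _ hx hy => rw [inner_add_left, hx, hy, add_zero]
    | smul a x _ hx => rw [inner_smul_left, hx, mul_zero]
  rw [Submodule.orthogonal_orthogonal] at hmem
  obtain ⟨x, hx⟩ := hmem
  exact ⟨x, hx.symm⟩

lemma linearIndependent_pair_of_inner_eq_zero {E : Type*} [NormedAddCommGroup E]
    [InnerProductSpace ℝ E] {X Y : E} (hX : X ≠ 0) (hY : Y ≠ 0) (h : inner ℝ X Y = 0) :
    LinearIndependent ℝ ![X, Y] := by
  rw [LinearIndependent.pair_iff]
  intro s t hst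
  have h1 := congrArg (inner ℝ X) hst
  have h2 := congrArg (inner ℝ Y) hst
  simp only [inner_add_right, inner_smul_right, h, real_inner_comm X Y, inner_zero_right,
    mul_zero, add_zero, zero_add, mul_eq_zero, inner_self_eq_zero, hX, hY, or_false] at h1 h2
  exact ⟨h1, h2⟩

/-! ### A limit argument -/

/-- The factor `r` changes sign at 0 while `q * r` stays non-negative, so `q` must vanish there; the
second claim is then the limit of the inequality divided by `t ^ 2`. In the application `q = h(X,
X)`, `r = h(Z, Z)` and `Q` is a Gram determinant. -/
lemma eq_zero_and_le_of_mul_ge {q r Q : ℝ → ℝ} {q' r' Q₀ δ : ℝ} (hq : HasDerivAt q q' 0)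
    (hr : HasDerivAt r r' 0) (hr0 : r 0 = 0) (hr' : r' ≠ 0) (hδ : 0 ≤ δ)
    (hQ : Tendsto (fun t => Q t / t ^ 2) (𝓝[≠] 0) (𝓝 Q₀))
    (hQ0 : ∀ᶠ t in 𝓝[≠] (0 : ℝ), 0 ≤ Q t)
    (h : ∀ᶠ t in 𝓝[≠] (0 : ℝ), δ * Q t ≤ q t * r t) : q 0 = 0 ∧ δ * Q₀ ≤ q' * r' := by
  have hrs : Tendsto (fun t => r t / t) (𝓝[≠] 0) (𝓝 r') := by
    refine (hasDerivAt_iff_tendsto_slope_zero.1 hr).congr fun t => ?_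
    rw [zero_add, hr0, sub_zero, smul_eq_mul, div_eq_inv_mul]
  have hqc : Tendsto q (𝓝[≠] 0) (𝓝 (q 0)) := hq.continuousAt.tendsto.mono_left nhdsWithin_le_nhds
  have hlim : Tendsto (fun t => q t * (r t / t)) (𝓝[≠] 0) (𝓝 (q 0 * r')) := hqc.mul hrs
  have hgt : 𝓝[>] (0 : ℝ) ≤ 𝓝[≠] 0 := nhdsWithin_mono _ fun t ht => ne_of_gt ht
  have hlt : 𝓝[<] (0 : ℝ) ≤ 𝓝[≠] 0 := nhdsWithin_mono _ fun t ht => ne_of_lt ht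
  -- Dividing by `t` preserves the sign for `t > 0` and reverses it for `t < 0`; the two one-sided
  -- limits agree.
  have h1 : 0 ≤ q 0 * r' := by
    refine ge_of_tendsto (hlim.mono_left hgt) ?_
    filter_upwards [hgt h, hgt hQ0, self_mem_nhdsWithin] with t ht htQ hpos
    rw [← mul_div_assoc]
    exact div_nonneg ((mul_nonneg hδ htQ).trans ht) (le_of_lt hpos)
  have h2 : q 0 * r' ≤ 0 := by
    refine le_of_tendsto (hlim.mono_left hlt) ?_
    filter_upwards [hlt h, hlt hQ0, self_mem_nhdsWithin] with t ht htQ hneg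
    rw [← mul_div_assoc]
    exact div_nonpos_of_nonneg_of_nonpos ((mul_nonneg hδ htQ).trans ht) (le_of_lt hneg)
  have hq0 : q 0 = 0 := (mul_eq_zero.1 (le_antisymm h2 h1)).resolve_right hr'
  refine ⟨hq0, ?_⟩
  have hqs : Tendsto (fun t => q t / t) (𝓝[≠] 0) (𝓝 q') := by
    refine (hasDerivAt_iff_tendsto_slope_zero.1 hq).congr fun t => ?_
    rw [zero_add, hq0, sub_zero, smul_eq_mul, div_eq_inv_mul]
  refine le_of_tendsto_of_tendsto (hQ.const_mul δ) (hqs.mul hrs) ?_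
  filter_upwards [h, self_mem_nhdsWithin] with t ht ht0
  have : 0 < t ^ 2 := by have : t ≠ 0 := ht0; positivity
  rw [← mul_div_assoc, div_mul_div_comm, ← pow_two]
  exact div_le_div_of_nonneg_right ht this.le

/-! ### Fronts in adapted coordinates -/

section Normal

variable {n N : ℕ} {F ν : Euc n → Euc N} {y : Euc n}

/-- Differentiate `⟨dF V, ν⟩ = 0` along `U`. This expresses the second fundamental form through
`dν`, also where `dF` degenerates. -/
lemma inner_snd_deriv_add_eq_zero (hF : ContDiffAt ℝ 2 F y) (hν : ContDiffAt ℝ 1 ν y)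
    (h : ∀ᶠ x in 𝓝 y, ∀ V, inner ℝ (fderiv ℝ F x V) (ν x) = 0) (U V : Euc n) :
    inner ℝ (fderiv ℝ (fderiv ℝ F) y U V) (ν y) +
      inner ℝ (fderiv ℝ F y V) (fderiv ℝ ν y U) = 0 := by
  have h0 : (fun x => inner ℝ (fderiv ℝ F x V) (ν x)) =ᶠ[𝓝 y] fun _ => (0 : ℝ) := by
    filter_upwards [h] with x hx using hx V
  have := congrArg (fun L : Euc n →L[ℝ] ℝ => L U) h0.fderiv_eq
  rw [fderiv_inner_apply ℝ (differentiableAt_fderiv_apply hF V)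
    (hν.differentiableAt (by norm_num)), fderiv_fderiv_apply hF] at this
  simp at this
  linarith

/-- Symmetry of the second fundamental form, inherited from the second derivative of `F`. -/
lemma inner_fderiv_comm (hF : ContDiffAt ℝ 2 F y) (hν : ContDiffAt ℝ 1 ν y)
    (h : ∀ᶠ x in 𝓝 y, ∀ V, inner ℝ (fderiv ℝ F x V) (ν x) = 0) (U V : Euc n) :
    inner ℝ (fderiv ℝ F y V) (fderiv ℝ ν y U) = inner ℝ (fderiv ℝ F y U) (fderiv ℝ ν y V) := by
  have h1 := inner_snd_deriv_add_eq_zero hF hν h U V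
  have h2 := inner_snd_deriv_add_eq_zero hF hν h V U
  rw [fderiv_fderiv_comm hF V U] at h2
  linarith

lemma inner_fderiv_unit_eq_zero (hν : ContDiffAt ℝ 1 ν y) (h : ∀ᶠ x in 𝓝 y, ‖ν x‖ = 1)
    (U : Euc n) : inner ℝ (ν y) (fderiv ℝ ν y U) = 0 := by
  have h0 : (fun x => inner ℝ (ν x) (ν x)) =ᶠ[𝓝 y] fun _ => (1 : ℝ) := by
    filter_upwards [h] with x hx
    rw [real_inner_self_eq_norm_sq, hx, one_pow]
  have := congrArg (fun L : Euc n →L[ℝ] ℝ => L U) h0.fderiv_eq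
  rw [fderiv_inner_apply ℝ (hν.differentiableAt (by norm_num))
    (hν.differentiableAt (by norm_num)), real_inner_comm (ν y) (fderiv ℝ ν y U)] at this
  simp at this
  linarith

end Normal

/-- The Gauss equation for hypersurfaces. -/
lemma sectionalCurvature_hypersurface {n : ℕ} {F : Euc n → Euc (n + 1)} {u : Euc n}
    (hF : ContDiffAt ℝ 3 F u) (hinj : Function.Injective (fderiv ℝ F u)) {ν : Euc (n + 1)}
    (hunit : ‖ν‖ = 1) (hν : ∀ V, inner ℝ (fderiv ℝ F u V) ν = 0) (X Y : Euc n) :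
    sectionalCurvature (pullbackMetric F) u X Y =
      (inner ℝ (fderiv ℝ (fderiv ℝ F) u X X) ν * inner ℝ (fderiv ℝ (fderiv ℝ F) u Y Y) ν -
        inner ℝ (fderiv ℝ (fderiv ℝ F) u X Y) ν ^ 2) /
      (inner ℝ (fderiv ℝ F u X) (fderiv ℝ F u X) * inner ℝ (fderiv ℝ F u Y) (fderiv ℝ F u Y) -
        inner ℝ (fderiv ℝ F u X) (fderiv ℝ F u Y) ^ 2) := by
  have hνν : inner ℝ ν ν = (1 : ℝ) := by rw [real_inner_self_eq_norm_sq, hunit, one_pow]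
  rw [sectionalCurvature_pullbackMetric hF hinj
    (fun X Y => inner ℝ (fderiv ℝ (fderiv ℝ F) u X Y) ν • ν)]
  · simp only [inner_smul_left, inner_smul_right, hνν, conj_trivial]
    ring
  · intro X Y V
    rw [inner_smul_left, real_inner_comm _ ν, hν, mul_zero]
  · intro X Y
    refine mem_range_of_inner_eq_zero hinj (w := ![ν]) ?_ rfl ?_ ?_
    · exact LinearIndependent.of_subsingleton 0 (by
        intro h; simp only [Matrix.cons_val_fin_one] at h; simp [h] at hunit)
    · intro i x
      simpa [real_inner_comm] using hν x
    · intro i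
      simp [inner_sub_right, inner_smul_right, hunit, real_inner_comm]

/-! ### Limits of the curvature at a singular point and the Gauss equation of the singular set -/

section Adapted

variable {k : ℕ} {F ν : Euc (k + 1) → Euc (k + 2)} {w : Euc k}

lemma hasDerivAt_line (y v : Euc k) : HasDerivAt (fun t : ℝ => y + t • v) v 0 := by
  simpa using ((hasDerivAt_id (0 : ℝ)).smul_const v).const_add y

lemma eventually_line {y : Euc k} {P : Euc k → Prop} (h : ∀ᶠ x in 𝓝 y, P x) (v : Euc k) :
    ∀ᶠ t in 𝓝 (0 : ℝ), P (y + t • v) := by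
  have : Tendsto (fun t : ℝ => y + t • v) (𝓝 0) (𝓝 y) := by
    simpa using (hasDerivAt_line y v).continuousAt.tendsto
  exact this.eventually h

lemma hasDerivAt_fderiv_line {n N : ℕ} {G : Euc n → Euc N} {y v : Euc n}
    (hG : ContDiffAt ℝ 2 G y) {Z : ℝ → Euc n} {Z' : Euc n} (hZ : HasDerivAt Z Z' 0) :
    HasDerivAt (fun t : ℝ => fderiv ℝ G (y + t • v) (Z t))
      (fderiv ℝ (fderiv ℝ G) y v (Z 0) + fderiv ℝ G y Z') 0 := by
  have h1 : HasFDerivAt (fderiv ℝ G) (fderiv ℝ (fderiv ℝ G) y) (y + (0 : ℝ) • v) := by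
    rw [zero_smul, add_zero]
    exact ((hG.fderiv_right (m := 1) (by norm_num)).differentiableAt (by norm_num)).hasFDerivAt
  have h2 := h1.comp_hasDerivAt (0 : ℝ) (hasDerivAt_line y v)
  have h3 := HasDerivAt.clm_apply h2 hZ
  simpa using h3

/-- The Gram determinant is quadratic in its second vector, and `G t / t` tends to `V`. -/
lemma tendsto_gram_div_sq {E : Type*} [NormedAddCommGroup E] [InnerProductSpace ℝ E]
    {A G : ℝ → E} {V : E} (hA : ContinuousAt A 0) (hG : HasDerivAt G V 0) (hG0 : G 0 = 0) :
    Tendsto (fun t => (inner ℝ (A t) (A t) * inner ℝ (G t) (G t) - inner ℝ (A t) (G t) ^ 2) / t ^ 2)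
      (𝓝[≠] 0) (𝓝 (inner ℝ (A 0) (A 0) * inner ℝ V V - inner ℝ (A 0) V ^ 2)) := by
  have hs : Tendsto (fun t : ℝ => t⁻¹ • G t) (𝓝[≠] 0) (𝓝 V) := by
    simpa [hG0] using hasDerivAt_iff_tendsto_slope_zero.1 hG
  have hA' : Tendsto A (𝓝[≠] 0) (𝓝 (A 0)) := hA.tendsto.mono_left nhdsWithin_le_nhds
  refine (((hA'.inner hA').mul (hs.inner hs)).sub ((hA'.inner hs).pow 2)).congr' ?_
  filter_upwards [self_mem_nhdsWithin] with t ht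
  have : t ≠ 0 := ht
  simp only [inner_smul_left, inner_smul_right, conj_trivial]
  field_simp

/-- At an `A₂`-point in adapted coordinates, a lower bound `δ ≥ 0` of the sectional curvature on
the planes that contain an extended null vector makes the limiting normal curvature vanish and the
second fundamental form of the singular set in the direction `∂ₜν` semi-definite, and definite
if `δ > 0`. -/
lemma second_fundamental_form_of_curvature_ge
    (hF : ContDiffAt ℝ 3 F (incl k w)) (hν : ContDiffAt ℝ 2 ν (incl k w))
    (hunit : ∀ᶠ y in 𝓝 (incl k w), ‖ν y‖ = 1)
    (hnormal : ∀ᶠ y in 𝓝 (incl k w), ∀ V, inner ℝ (fderiv ℝ F y V) (ν y) = 0)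
    (hnull : ∀ᶠ x in 𝓝 w, fderiv ℝ F (incl k x) (vert k) = 0)
    (himm : Function.Injective fun X => fderiv ℝ F (incl k w) (incl k X))
    (ha : inner ℝ (fderiv ℝ (fderiv ℝ F) (incl k w) (vert k) (vert k))
      (fderiv ℝ ν (incl k w) (vert k)) ≠ 0)
    (hreg : ∀ᶠ t in 𝓝[≠] (0 : ℝ), Function.Injective (fderiv ℝ F (incl k w + t • vert k)))
    {Z : ℝ → Euc (k + 1)} (hZ : DifferentiableAt ℝ Z 0) (hZ0 : Z 0 = vert k)
    {δ : ℝ} (hδ : 0 ≤ δ) {X : Euc k} (hX : X ≠ 0)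
    (hK : ∀ᶠ t in 𝓝[≠] (0 : ℝ),
      δ ≤ sectionalCurvature (pullbackMetric F) (incl k w + t • vert k) (incl k X) (Z t)) :
    inner ℝ (fderiv ℝ (fderiv ℝ F) (incl k w) (incl k X) (incl k X)) (ν (incl k w)) = 0 ∧
    ∃ Q > 0, δ * Q ≤ -(inner ℝ (fderiv ℝ (fderiv ℝ F) (incl k w) (incl k X) (incl k X))
        (fderiv ℝ ν (incl k w) (vert k)) *
      inner ℝ (fderiv ℝ (fderiv ℝ F) (incl k w) (vert k) (vert k))
        (fderiv ℝ ν (incl k w) (vert k))) := by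
  set y₀ := incl k w with hy₀
  set n := fderiv ℝ ν y₀ (vert k) with hn
  have hF2 : ContDiffAt ℝ 2 F y₀ := hF.of_le (by norm_num)
  have hν1 : ContDiffAt ℝ 1 ν y₀ := hν.of_le (by norm_num)
  have hnull0 : fderiv ℝ F y₀ (vert k) = 0 := hnull.self_of_nhds
  -- Symmetry moves the null vector onto `F`: `⟨F_V, ν_t⟩ = ⟨F_t, ν_V⟩ = 0`.
  have hperp : ∀ V, inner ℝ (fderiv ℝ F y₀ V) n = 0 := fun V => by
    rw [hn, inner_fderiv_comm hF2 hν1 hnormal, hnull0, inner_zero_left]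
  have hF2ev := hF2.eventually (by simp)
  have hν1ev := hν1.eventually (by simp)
  have hcomm : ∀ᶠ y in 𝓝 y₀, ∀ U V, inner ℝ (fderiv ℝ (fderiv ℝ F) y U V) (ν y) =
      -inner ℝ (fderiv ℝ F y V) (fderiv ℝ ν y U) := by
    filter_upwards [hF2ev, hν1ev, hnormal.eventually_nhds] with y h1 h2 h3 U V
    linarith [inner_snd_deriv_add_eq_zero h1 h2 h3 U V]
  have hcomm' : ∀ᶠ y in 𝓝 y₀, ∀ U V, inner ℝ (fderiv ℝ F y V) (fderiv ℝ ν y U) =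
      inner ℝ (fderiv ℝ F y U) (fderiv ℝ ν y V) := by
    filter_upwards [hF2ev, hν1ev, hnormal.eventually_nhds] with y h1 h2 h3 U V
    exact inner_fderiv_comm h1 h2 h3 U V
  -- the mixed second derivatives of `F` vanish
  have hmixed : fderiv ℝ (fderiv ℝ F) y₀ (vert k) (incl k X) = 0 := by
    have h0 : (fun t : ℝ => fderiv ℝ F (y₀ + t • incl k X) (vert k)) =ᶠ[𝓝 0]
        fun _ => (0 : Euc (k + 2)) := by
      filter_upwards [eventually_line hnull X] with t ht
      simpa [hy₀] using ht
    have h1 := (hasDerivAt_fderiv_line (v := incl k X) hF2 (hasDerivAt_const (0 : ℝ) (vert k))).deriv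
    rw [h0.deriv_eq] at h1
    rw [fderiv_fderiv_comm hF2]
    simpa using h1.symm
  -- differentiating `⟨F_X, ν_t⟩ = 0` in the direction `X`
  have hXt : inner ℝ (fderiv ℝ (fderiv ℝ F) y₀ (incl k X) (incl k X)) n +
      inner ℝ (fderiv ℝ F y₀ (incl k X)) (fderiv ℝ (fderiv ℝ ν) y₀ (vert k) (incl k X)) = 0 := by
    have h0 : (fun t : ℝ => inner ℝ (fderiv ℝ F (y₀ + t • incl k X) (incl k X))
        (fderiv ℝ ν (y₀ + t • incl k X) (vert k))) =ᶠ[𝓝 0] fun _ => (0 : ℝ) := by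
      filter_upwards [eventually_line hnull X, eventually_line hcomm' (incl k X)] with t ht hc
      rw [hc]
      simp only [map_add, map_smul, ← hy₀] at ht
      rw [ht, inner_zero_left]
    have h1 := ((hasDerivAt_fderiv_line (v := incl k X) hF2
      (hasDerivAt_const (0 : ℝ) (incl k X))).inner ℝ (hasDerivAt_fderiv_line (v := incl k X) hν
      (hasDerivAt_const (0 : ℝ) (vert k)))).deriv
    rw [h0.deriv_eq] at h1
    rw [fderiv_fderiv_comm hν (vert k)]
    simp only [deriv_const, zero_smul, add_zero, map_zero] at h1
    rw [← hn] at h1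
    linarith
  obtain ⟨Z', hZ'⟩ : ∃ Z', HasDerivAt Z Z' 0 := ⟨_, hZ.hasDerivAt⟩
  -- The velocity at 0 of `F_Z` along the `t`-axis. The term from `Z'` is tangential and does not
  -- contribute to `⟨V, n⟩`.
  set V := fderiv ℝ (fderiv ℝ F) y₀ (vert k) (vert k) + fderiv ℝ F y₀ Z' with hV
  have hVn : inner ℝ V n = inner ℝ (fderiv ℝ (fderiv ℝ F) y₀ (vert k) (vert k)) n := by
    rw [hV, inner_add_left, hperp, add_zero]
  have hA := hasDerivAt_fderiv_line (v := vert k) hF2 (hasDerivAt_const (0 : ℝ) (incl k X))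
  have hB := hasDerivAt_fderiv_line (v := vert k) hν (hasDerivAt_const (0 : ℝ) (incl k X))
  have hG := hasDerivAt_fderiv_line (v := vert k) hF2 hZ'
  have hH := hasDerivAt_fderiv_line (v := vert k) hν hZ'
  -- The functions `h(X, X)` and `h(Z, Z)` along the `t`-axis, written as `-⟨F_X, ν_X⟩` and `-⟨F_Z,
  -- ν_Z⟩`.
  have hq := (hA.inner ℝ hB).neg
  have hr := (hG.inner ℝ hH).neg
  simp only [map_zero, add_zero, zero_smul, hZ0, hnull0, inner_zero_left, hmixed, zero_add,
    ← hV, ← hn] at hq hr hG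
  have hQ := tendsto_gram_div_sq hA.continuousAt hG (by simp [hZ0, hnull0])
  simp only [zero_smul, add_zero] at hQ
  have hX0 : fderiv ℝ F y₀ (incl k X) ≠ 0 := fun h => hX (himm (by simpa using h))
  have hQpos : 0 < inner ℝ (fderiv ℝ F y₀ (incl k X)) (fderiv ℝ F y₀ (incl k X)) * inner ℝ V V -
      inner ℝ (fderiv ℝ F y₀ (incl k X)) V ^ 2 := by
    -- Pairing a linear relation with `n` removes `F_X` and isolates the coefficient of `V`, since
    -- `⟨V, n⟩ ≠ 0`.
    refine gram_pos (LinearIndependent.pair_iff.2 fun s t hst => ?_)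
    have h1 := congrArg (fun v => inner ℝ v n) hst
    simp only [inner_add_left, inner_smul_left, hperp, hVn, mul_zero, zero_add, inner_zero_left,
      mul_eq_zero, ha, or_false, conj_trivial] at h1
    subst h1
    simpa [hX0] using hst
  have hle : 𝓝[≠] (0 : ℝ) ≤ 𝓝 0 := nhdsWithin_le_nhds
  have hheight : ∀ᶠ t in 𝓝 (0 : ℝ), height k (Z t) ≠ 0 := by
    refine ((height k).continuous.continuousAt.comp hZ.continuousAt).eventually_ne ?_
    simp [hZ0]
  have hpos : ∀ᶠ t in 𝓝[≠] (0 : ℝ), 0 <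
      inner ℝ (fderiv ℝ F (y₀ + t • vert k) (incl k X)) (fderiv ℝ F (y₀ + t • vert k) (incl k X)) *
      inner ℝ (fderiv ℝ F (y₀ + t • vert k) (Z t)) (fderiv ℝ F (y₀ + t • vert k) (Z t)) -
      inner ℝ (fderiv ℝ F (y₀ + t • vert k) (incl k X)) (fderiv ℝ F (y₀ + t • vert k) (Z t)) ^ 2 := by
    filter_upwards [hreg, hle hheight] with t ht hth
    exact gram_pos (linearIndependent_pair_map ht (linearIndependent_incl hX hth))
  have hfin := eq_zero_and_le_of_mul_ge hq hr (by simp [hZ0, hnull0])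
    (by simpa [hVn] using ha) hδ hQ (hpos.mono fun t ht => ht.le) ?_
  · obtain ⟨h1, h2⟩ := hfin
    simp only [Pi.neg_apply, zero_smul, add_zero] at h1
    refine ⟨by rw [hcomm.self_of_nhds]; exact h1, _, hQpos, ?_⟩
    refine h2.trans (le_of_eq ?_)
    rw [← hVn, show inner ℝ (fderiv ℝ (fderiv ℝ F) y₀ (incl k X) (incl k X)) n =
      -inner ℝ (fderiv ℝ F y₀ (incl k X)) (fderiv ℝ (fderiv ℝ ν) y₀ (vert k) (incl k X)) by
        linarith]
    simp
  -- Off `t = 0` the Gauss equation applies; the square of the mixed term has the favourable sign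
  -- and is dropped.
  · filter_upwards [hK, hpos, hreg, hle (eventually_line hcomm (vert k)),
      hle (eventually_line hunit (vert k)), hle (eventually_line hnormal (vert k)),
      hle (eventually_line (hF.eventually (by simp)) (vert k))] with t h1 h2 h3 h4 h5 h6 h7
    rw [sectionalCurvature_hypersurface h7 h3 h5 h6, le_div_iff₀ h2] at h1
    simp only [h4] at h1
    simp only [Pi.neg_apply]
    nlinarith [sq_nonneg (inner ℝ (fderiv ℝ F (y₀ + t • vert k) (Z t))
      (fderiv ℝ ν (y₀ + t • vert k) (incl k X)))]

/-- The sectional curvature of the singular set of a front, in adapted coordinates, under a lower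
bound `δ ≥ 0` of the curvature of the front on the planes that contain an extended null vector. -/
theorem singular_curvature_of_curvature_ge
    (hF : ContDiffAt ℝ 3 F (incl k w)) (hν : ContDiffAt ℝ 2 ν (incl k w))
    (hunit : ∀ᶠ y in 𝓝 (incl k w), ‖ν y‖ = 1)
    (hnormal : ∀ᶠ y in 𝓝 (incl k w), ∀ V, inner ℝ (fderiv ℝ F y V) (ν y) = 0)
    (hnull : ∀ᶠ x in 𝓝 w, fderiv ℝ F (incl k x) (vert k) = 0)
    (himm : Function.Injective fun X => fderiv ℝ F (incl k w) (incl k X))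
    (hfront : fderiv ℝ ν (incl k w) (vert k) ≠ 0)
    {c : Euc (k + 2)} (hc : ∀ V, inner ℝ (fderiv ℝ F (incl k w) V) c = 0)
    (hc' : inner ℝ (fderiv ℝ (fderiv ℝ F) (incl k w) (vert k) (vert k)) c ≠ 0)
    (hreg : ∀ᶠ t in 𝓝[≠] (0 : ℝ), Function.Injective (fderiv ℝ F (incl k w + t • vert k)))
    {Z : ℝ → Euc (k + 1)} (hZ : DifferentiableAt ℝ Z 0) (hZ0 : Z 0 = vert k)
    {δ : ℝ} (hδ : 0 ≤ δ)
    (hK : ∀ X ≠ 0, ∀ᶠ t in 𝓝[≠] (0 : ℝ),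
      δ ≤ sectionalCurvature (pullbackMetric F) (incl k w + t • vert k) (incl k X) (Z t))
    {X Y : Euc k} (hXY : LinearIndependent ℝ ![X, Y]) :
    0 ≤ sectionalCurvature (pullbackMetric (F ∘ incl k)) w X Y ∧
      (0 < δ → 0 < sectionalCurvature (pullbackMetric (F ∘ incl k)) w X Y) := by
  set y₀ := incl k w with hy₀
  set n := fderiv ℝ ν y₀ (vert k) with hn
  have hF2 : ContDiffAt ℝ 2 F y₀ := hF.of_le (by norm_num)
  have hν1 : ContDiffAt ℝ 1 ν y₀ := hν.of_le (by norm_num)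
  have hnull0 : fderiv ℝ F y₀ (vert k) = 0 := hnull.self_of_nhds
  have hperp : ∀ V, inner ℝ (fderiv ℝ F y₀ V) n = 0 := fun V => by
    rw [hn, inner_fderiv_comm hF2 hν1 hnormal, hnull0, inner_zero_left]
  have hνn : inner ℝ (ν y₀) n = 0 := inner_fderiv_unit_eq_zero hν1 hunit _
  have hνν : ν y₀ ≠ 0 := fun h => by
    have := hunit.self_of_nhds
    simp [h] at this
  -- `ν` and `n` span the orthogonal complement of a `k`-dimensional image in `ℝᵏ⁺²`.
  have hrange : ∀ v : Euc (k + 2), inner ℝ (ν y₀) v = 0 → inner ℝ n v = 0 →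
      ∃ x, v = ((fderiv ℝ F y₀).comp (incl k)) x := by
    intro v h1 h2
    refine mem_range_of_inner_eq_zero (r := 2) himm
      (linearIndependent_pair_of_inner_eq_zero hνν hfront hνn) rfl ?_ ?_
    · intro i x
      fin_cases i
      · simpa [real_inner_comm] using hnormal.self_of_nhds (incl k x)
      · simpa [real_inner_comm] using hperp (incl k x)
    · intro i
      fin_cases i
      · exact h1
      · exact h2
  -- the second derivative in the null direction is not tangent
  have ha : inner ℝ (fderiv ℝ (fderiv ℝ F) y₀ (vert k) (vert k)) n ≠ 0 := by
    intro h0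
    -- `⟨F_tt, ν⟩ = -⟨F_t, ν_t⟩ = 0` in any case, so `a = 0` would make `F_tt` tangent and
    -- contradict `hc'`.
    obtain ⟨x, hx⟩ := hrange (fderiv ℝ (fderiv ℝ F) y₀ (vert k) (vert k)) (by
      have := inner_snd_deriv_add_eq_zero hF2 hν1 hnormal (vert k) (vert k)
      rwa [hnull0, inner_zero_left, add_zero, real_inner_comm] at this)
      (by rwa [real_inner_comm])
    exact hc' (by rw [hx]; exact hc _)
  set a := inner ℝ (fderiv ℝ (fderiv ℝ F) y₀ (vert k) (vert k)) n with ha_def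
  set B : Euc k → Euc k → ℝ := fun X Y =>
    inner ℝ (fderiv ℝ (fderiv ℝ F) y₀ (incl k X) (incl k Y)) n with hB
  have hform : ∀ X ≠ 0, inner ℝ (fderiv ℝ (fderiv ℝ F) y₀ (incl k X) (incl k X)) (ν y₀) = 0 ∧
      ∃ Q > 0, δ * Q ≤ -(B X X * a) := fun X hX =>
    second_fundamental_form_of_curvature_ge hF hν hunit hnormal hnull himm ha hreg hZ hZ0 hδ hX
      (hK X hX)
  have hh : ∀ X, inner ℝ (fderiv ℝ (fderiv ℝ F) y₀ (incl k X) (incl k X)) (ν y₀) = 0 := by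
    intro X
    by_cases hX : X = 0
    · simp [hX]
    · exact (hform X hX).1
  -- Polarization of `hh`.
  have hh' : ∀ X Y, inner ℝ (fderiv ℝ (fderiv ℝ F) y₀ (incl k X) (incl k Y)) (ν y₀) = 0 := by
    intro X Y
    have h1 := hh (X + Y)
    simp only [map_add, add_apply, inner_add_left, hh] at h1
    rw [fderiv_fderiv_comm hF2 (incl k Y) (incl k X)] at h1
    linarith
  have hBsymm : ∀ X Y, B X Y = B Y X := fun X Y => by
    simp only [hB]; rw [fderiv_fderiv_comm hF2]
  have hBquad : ∀ s : ℝ, B (X + s • Y) (X + s • Y) = B X X + 2 * s * B X Y + s ^ 2 * B Y Y := by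
    intro s
    have := hBsymm X Y
    simp only [hB] at this ⊢
    simp only [map_add, map_smul, add_apply, smul_apply, inner_add_left, inner_smul_left,
      conj_trivial, ← this]
    ring
  have hnn : 0 < inner ℝ n n := real_inner_self_pos.2 hfront
  -- the Gauss equation of the singular set
  have hincl : ∀ᶠ x in 𝓝 w, ContDiffAt ℝ 2 F (incl k x) :=
    (incl k).continuous.continuousAt.eventually (hF2.eventually (by simp))
  have hd1 : fderiv ℝ (F ∘ incl k) =ᶠ[𝓝 w] fun x => (fderiv ℝ F (incl k x)).comp (incl k) := by
    filter_upwards [hincl] with x hx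
    rw [fderiv_comp x (hx.differentiableAt (by norm_num)) (incl k).differentiableAt,
      ContinuousLinearMap.fderiv]
  have hd1' : fderiv ℝ (F ∘ incl k) w = (fderiv ℝ F y₀).comp (incl k) := hd1.eq_of_nhds
  have hd2 : ∀ X Y, fderiv ℝ (fderiv ℝ (F ∘ incl k)) w X Y =
      fderiv ℝ (fderiv ℝ F) y₀ (incl k X) (incl k Y) := by
    intro X Y
    have hD : DifferentiableAt ℝ (fderiv ℝ F) (incl k w) :=
      (hF2.fderiv_right (m := 1) (by norm_num)).differentiableAt (by norm_num)
    rw [hd1.fderiv_eq]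
    have h1 : HasFDerivAt (fun x => fderiv ℝ F (incl k x))
        ((fderiv ℝ (fderiv ℝ F) y₀).comp (incl k)) w :=
      hD.hasFDerivAt.comp w (incl k).hasFDerivAt
    rw [(h1.clm_comp (hasFDerivAt_const (incl k) w)).fderiv]
    simp
  have hinj : Function.Injective (fderiv ℝ (F ∘ incl k) w) := by
    rw [hd1']; exact himm
  -- By `hh'` the second fundamental form of the singular set has no `ν`-component, so it is a
  -- multiple of `n`.
  have hgauss := sectionalCurvature_pullbackMetric
    (hF.comp w (incl k).contDiff.contDiffAt) hinj
    (fun X Y => (B X Y / inner ℝ n n) • n)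
    (fun X Y V => by
      rw [hd1', inner_smul_left, ContinuousLinearMap.comp_apply,
        real_inner_comm (fderiv ℝ F y₀ (incl k V)) n, hperp, mul_zero])
    (fun X Y => by
      rw [hd2, hd1']
      refine hrange _ ?_ ?_
      · rw [inner_sub_right, inner_smul_right, hνn, mul_zero, sub_zero, real_inner_comm, hh']
      · rw [inner_sub_right, inner_smul_right, div_mul_cancel₀ _ hnn.ne', real_inner_comm,
          sub_self]) X Y
  have hden := gram_pos (linearIndependent_pair_map hinj hXY)
  -- Multiplying through by `a ^ 2` exhibits the 2 × 2 determinant of `-a B`, whose sign is known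
  -- whatever the sign of `a`.
  have hnum : inner ℝ ((B X X / inner ℝ n n) • n) ((B Y Y / inner ℝ n n) • n) -
      inner ℝ ((B X Y / inner ℝ n n) • n) ((B X Y / inner ℝ n n) • n) =
      (-(B X X * a) * -(B Y Y * a) - (-(B X Y * a)) ^ 2) / (a ^ 2 * inner ℝ n n) := by
    simp only [inner_smul_left, inner_smul_right, conj_trivial]
    field_simp
  have hden' : 0 < a ^ 2 * inner ℝ n n := by positivity
  rw [hgauss, hnum]
  have hge : ∀ X, 0 ≤ -(B X X * a) := by
    intro X
    by_cases hX : X = 0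
    · simp [hX, hB]
    · obtain ⟨-, Q, hQ, h⟩ := hform X hX
      exact (mul_nonneg hδ hQ.le).trans h
  refine ⟨div_nonneg (div_nonneg (mul_sub_sq_nonneg_of_forall fun s => ?_) hden'.le) hden.le,
    fun hδ' => div_pos (div_pos (mul_sub_sq_pos_of_forall ?_ fun s => ?_) hden') hden⟩
  · have := hge (X + s • Y)
    rw [hBquad] at this
    linarith
  · obtain ⟨-, Q, hQ, h⟩ := hform Y (by simpa using hXY.ne_zero 1)
    exact (mul_pos hδ' hQ).trans_le h
  · obtain ⟨-, Q, hQ, h⟩ := hform _ (add_smul_ne_zero_of_pair hXY s)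
    have := (mul_pos hδ' hQ).trans_le h
    rw [hBquad] at this
    linarith

end Adapted

/-! ### The derivative of a determinant that vanishes -/

/-- Take for `c` the `j`-th column of the adjugate of `A 0`, where `x j ≠ 0`, and differentiate the
`j`-th entry of `x A adj(A) = det(A) x`. The derivative of the adjugate is multiplied by `x A(0) =
0`, so what remains is `s' · c = (det A)'(0) xⱼ`. -/
lemma exists_mulVec_eq_zero_of_deriv_det_ne_zero {ι : Type*} [Fintype ι] [DecidableEq ι]
    {A : ℝ → Matrix ι ι ℝ} (hA : ∀ i j, ContDiffAt ℝ 1 (fun t => A t i j) 0)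
    {x s' : ι → ℝ} (hx : x ≠ 0) (hx0 : Matrix.vecMul x (A 0) = 0)
    (hs' : ∀ l, HasDerivAt (fun t => Matrix.vecMul x (A t) l) (s' l) 0)
    (hd : deriv (fun t => (A t).det) 0 ≠ 0) :
    ∃ c, Matrix.mulVec (A 0) c = 0 ∧ ∑ l, s' l * c l ≠ 0 := by
  obtain ⟨j, hj⟩ : ∃ j, x j ≠ 0 := by
    by_contra! h
    exact hx (funext h)
  have hdet : (A 0).det = 0 := Matrix.exists_vecMul_eq_zero_iff.1 ⟨x, hx, hx0⟩
  refine ⟨fun l => (A 0).adjugate l j, ?_, ?_⟩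
  · ext i
    have := congrFun (congrFun (Matrix.mul_adjugate (A 0)) i) j
    rw [hdet, zero_smul] at this
    exact this
  · have heq : (fun t => ∑ l, Matrix.vecMul x (A t) l * (A t).adjugate l j) =
        fun t => (A t).det * x j := by
      funext t
      have := congrArg (fun B => Matrix.vecMul x B j) (Matrix.mul_adjugate (A t))
      simp only [← Matrix.vecMul_vecMul, Matrix.vecMul_smul, Matrix.vecMul_one, Pi.smul_apply,
        smul_eq_mul] at this
      exact this
    have h1 : HasDerivAt (fun t => ∑ l, Matrix.vecMul x (A t) l * (A t).adjugate l j)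
        (∑ l, s' l * (A 0).adjugate l j) 0 := by
      refine HasDerivAt.fun_sum fun l _ => ?_
      have h2 := ((contDiffAt_matrix_adjugate hA l j).differentiableAt (by norm_num)).hasDerivAt
      have h3 := (hs' l).fun_mul h2
      rw [hx0, Pi.zero_apply, zero_mul, add_zero] at h3
      exact h3
    rw [heq] at h1
    have h4 := (((contDiffAt_matrix_det hA).differentiableAt
      (by norm_num)).hasDerivAt.mul_const (x j))
    rw [h1.unique h4]
    exact mul_ne_zero hd hj

/-! ### Injective derivatives and the inverse function theorem -/

lemma injective_iff_linearIndependent_stdVec {n N : ℕ} (A : Euc n →L[ℝ] Euc N) :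
    Function.Injective A ↔ LinearIndependent ℝ fun i => A (stdVec i) := by
  constructor
  · intro h
    refine Fintype.linearIndependent_iff.2 fun g hg i => ?_
    have h1 : A (WithLp.toLp 2 g) = 0 := by rw [map_eq_sum]; exact hg
    exact congrArg (fun z : Euc n => z i) (h (h1.trans (map_zero A).symm))
  · intro h
    refine (injective_iff_map_eq_zero A).2 fun X hX => ?_
    rw [map_eq_sum] at hX
    have := Fintype.linearIndependent_iff.1 h (fun i => X i) hX
    ext i
    exact this i

/-- Injectivity is linear independence of the images of the basis vectors, an open condition. -/
lemma eventually_injective {n N : ℕ} {E : Type*} [TopologicalSpace E]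
    {A : E → Euc n →L[ℝ] Euc N} {y : E} (hA : ContinuousAt A y)
    (h : Function.Injective (A y)) : ∀ᶠ x in 𝓝 y, Function.Injective (A x) := by
  have h1 := ((injective_iff_linearIndependent_stdVec _).1 h).eventually
  have h2 : ContinuousAt (fun x => fun i : Fin n => A x (stdVec i)) y :=
    continuousAt_pi.2 fun i => hA.clm_apply continuousAt_const
  filter_upwards [h2.eventually h1] with x hx
  exact (injective_iff_linearIndependent_stdVec _).2 hx

lemma exists_equiv_of_injective {n : ℕ} {A : Euc n →L[ℝ] Euc n} (hA : Function.Injective A) :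
    ∃ e : Euc n ≃L[ℝ] Euc n, (e : Euc n →L[ℝ] Euc n) = A :=
  ⟨(LinearEquiv.ofInjectiveEndo A.toLinearMap hA).toContinuousLinearEquiv, by ext; rfl⟩

/-- The **inverse function theorem**, for smooth maps on an open subset of `ℝⁿ`. -/
lemma exists_local_diffeo {n : ℕ} {G : Euc n → Euc n} {B : Set (Euc n)} (hB : IsOpen B)
    (hG : ContDiffOn ℝ ∞ G B) {y : Euc n} (hy : y ∈ B)
    (hinj : Function.Injective (fderiv ℝ G y)) :
    ∃ e : OpenPartialHomeomorph (Euc n) (Euc n), y ∈ e.source ∧ e.source ⊆ B ∧ (e : _ → _) = G ∧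
      (∀ x ∈ e.source, Function.Injective (fderiv ℝ G x)) ∧ ContDiffOn ℝ ∞ e.symm e.target := by
  have hGat : ∀ x ∈ B, ContDiffAt ℝ ∞ G x := fun x hx => hG.contDiffAt (hB.mem_nhds hx)
  -- Restricting to the points with injective derivative makes the inverse smooth on the whole
  -- target.
  set B' : Set (Euc n) := {x | x ∈ B ∧ Function.Injective (fderiv ℝ G x)} with hB'
  have hB'o : IsOpen B' := by
    rw [isOpen_iff_mem_nhds]
    rintro x ⟨hx, hxi⟩
    have hc : ContinuousAt (fderiv ℝ G) x :=
      ((hGat x hx).fderiv_right (m := 1) (by norm_cast)).continuousAt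
    filter_upwards [hB.mem_nhds hx, eventually_injective hc hxi] with z h1 h2 using ⟨h1, h2⟩
  obtain ⟨A, hA⟩ := exists_equiv_of_injective hinj
  have hs : HasStrictFDerivAt G (A : Euc n →L[ℝ] Euc n) y := by
    rw [hA]; exact (hGat y hy).hasStrictFDerivAt (by simp)
  set e := (hs.toOpenPartialHomeomorph G).restrOpen B' hB'o with he
  have hsrc : e.source = (hs.toOpenPartialHomeomorph G).source ∩ B' := rfl
  have hcoe : (e : _ → _) = G := rfl
  refine ⟨e, ?_, ?_, hcoe, ?_, ?_⟩
  · rw [hsrc]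
    exact ⟨hs.mem_toOpenPartialHomeomorph_source, hy, hinj⟩
  · rw [hsrc]
    exact fun x hx => hx.2.1
  · rw [hsrc]
    exact fun x hx => hx.2.2
  · intro z hz
    have hx : e.symm z ∈ e.source := e.map_target hz
    rw [hsrc] at hx
    obtain ⟨A', hA'⟩ := exists_equiv_of_injective hx.2.2
    refine (e.contDiffAt_symm hz (f₀' := A') ?_ ?_).contDiffWithinAt
    · rw [hA', hcoe]
      exact ((hGat _ hx.2.1).differentiableAt (by simp)).hasFDerivAt
    · rw [hcoe]; exact hGat _ hx.2.1

/-! ### Local parametrizations -/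

section Param

variable {m : ℕ} {M : Type*} [TopologicalSpace M] [ChartedSpace (Euc m) M]

lemma fderiv_comp_mfderiv {n N : ℕ} {γ : Euc n → M} {f : M → Euc N} {x : Euc n}
    (hf : MDifferentiableAt (𝓡 m) (𝓡 N) f (γ x)) (hγ : MDifferentiableAt (𝓡 n) (𝓡 m) γ x)
    (V : Euc n) :
    fderiv ℝ (f ∘ γ) x V = mfderiv (𝓡 m) (𝓡 N) f (γ x) (mfderiv (𝓡 n) (𝓡 m) γ x V) := by
  rw [← mfderiv_eq_fderiv, mfderiv_comp x hf hγ]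
  rfl

/-- A left inverse differentiable at the points of the image gives the immersion by the chain rule
and the embedding by its continuity. -/
lemma IsLocalParam.of_leftInverse {n : ℕ} {S : Set M} {W : Set (Euc n)} {γ : Euc n → M}
    {h : M → Euc n} (hW : IsOpen W) (hγ : ContMDiffOn (𝓡 n) (𝓡 m) ∞ γ W)
    (hh : ∀ x ∈ W, MDifferentiableAt (𝓡 m) (𝓡 n) h (γ x)) (hhγ : ∀ x ∈ W, h (γ x) = x)
    (himage : ∃ O : Set M, IsOpen O ∧ γ '' W = S ∩ O) : IsLocalParam m n S W γ where
  isOpen := hW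
  smooth := hγ
  immersion := by
    intro x hx
    have hd : MDifferentiableAt (𝓡 n) (𝓡 m) γ x :=
      (hγ.contMDiffAt (hW.mem_nhds hx)).mdifferentiableAt (by simp)
    have heq : h ∘ γ =ᶠ[𝓝 x] id := by
      filter_upwards [hW.mem_nhds hx] with z hz using hhγ z hz
    have hid : ∀ V, mfderiv (𝓡 m) (𝓡 n) h (γ x) (mfderiv (𝓡 n) (𝓡 m) γ x V) = V := by
      intro V
      have h1 := fderiv_comp_mfderiv (hh x hx) hd V
      rw [heq.fderiv_eq, fderiv_id] at h1
      exact h1.symm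
    intro V V' hV
    rw [← hid V, hV, hid]
  embedding := by
    refine ⟨?_, ?_⟩
    · rw [Topology.isInducing_iff_nhds]
      rintro ⟨x, hx⟩
      refine le_antisymm ?_ ?_
      · rw [← tendsto_iff_comap]
        exact (hγ.continuousOn.domRestrict).continuousAt
      · rw [nhds_subtype_eq_comap]
        have hc : Tendsto h (𝓝 (γ x)) (𝓝 x) := by
          simpa [hhγ x hx] using (hh x hx).continuousAt.tendsto
        refine (comap_mono hc.le_comap).trans ?_
        rw [comap_comap]
        refine le_of_eq ?_
        congr 1
        funext z
        exact hhγ z z.2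
    · rintro ⟨x, hx⟩ ⟨z, hz⟩ hxz
      have h1 : γ x = γ z := hxz
      exact Subtype.ext ((hhγ x hx).symm.trans ((congrArg h h1).trans (hhγ z hz)))
  image := himage

end Param

/-! ### The Jacobian function -/

section Jacobian

variable {m : ℕ}

/-- The square matrix with the rows `A e₁, …, A eₘ, v`. -/
noncomputable def jacobianMatrix (A : Euc m →L[ℝ] Euc (m + 1)) (v : Euc (m + 1)) :
    Matrix (Fin (m + 1)) (Fin (m + 1)) ℝ :=
  Matrix.of fun i j => (Fin.snoc (α := fun _ => Euc (m + 1)) (fun a : Fin m => A (stdVec a)) v i) j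

lemma vecMul_jacobianMatrix (A : Euc m →L[ℝ] Euc (m + 1)) (v : Euc (m + 1))
    (x : Fin (m + 1) → ℝ) (j : Fin (m + 1)) :
    Matrix.vecMul x (jacobianMatrix A v) j =
      (A (WithLp.toLp 2 fun i => x i.castSucc) + x (Fin.last m) • v) j := by
  rw [map_eq_sum]
  simp [Matrix.vecMul, dotProduct, Fin.sum_univ_castSucc, jacobianMatrix]

lemma mulVec_jacobianMatrix_castSucc (A : Euc m →L[ℝ] Euc (m + 1)) (v : Euc (m + 1))
    (c : Fin (m + 1) → ℝ) (a : Fin m) :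
    Matrix.mulVec (jacobianMatrix A v) c a.castSucc =
      inner ℝ (A (stdVec a)) (WithLp.toLp 2 c) := by
  simp [Matrix.mulVec, dotProduct, jacobianMatrix, PiLp.inner_apply, mul_comm]

/-- The last row is a unit vector orthogonal to the others, so it enters no linear relation among
the rows. -/
lemma det_jacobianMatrix_eq_zero_iff {A : Euc m →L[ℝ] Euc (m + 1)} {v : Euc (m + 1)}
    (hv : ‖v‖ = 1) (hA : ∀ X, inner ℝ (A X) v = 0) :
    (jacobianMatrix A v).det = 0 ↔ ¬ Function.Injective A := by
  rw [← Matrix.exists_vecMul_eq_zero_iff]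
  constructor
  · rintro ⟨x, hx, h0⟩ hinj
    have h1 : A (WithLp.toLp 2 fun i => x i.castSucc) + x (Fin.last m) • v = 0 := by
      ext j
      rw [← vecMul_jacobianMatrix, h0]; rfl
    have h2 := congrArg (fun z => inner ℝ z v) h1
    simp only [inner_add_left, hA, inner_smul_left, real_inner_self_eq_norm_sq, hv,
      inner_zero_left, zero_add, one_pow, mul_one, conj_trivial] at h2
    rw [h2, zero_smul, add_zero] at h1
    have h3 := hinj (h1.trans (map_zero A).symm)
    refine hx (funext fun i => ?_)
    refine Fin.lastCases h2 (fun a => ?_) i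
    exact congrArg (fun z : Euc m => z a) h3
  · intro hinj
    rw [injective_iff_map_eq_zero] at hinj
    push Not at hinj
    obtain ⟨X, hX, hX0⟩ := hinj
    refine ⟨Fin.snoc (α := fun _ => ℝ) X.ofLp 0, fun h => hX0 ?_, ?_⟩
    · ext a
      simpa using congrFun h a.castSucc
    · ext j
      rw [vecMul_jacobianMatrix]
      simp [hX]

end Jacobian

section Chart

variable {m : ℕ} {M : Type*} [TopologicalSpace M] [ChartedSpace (Euc m) M]
  {f ν : M → Euc (m + 1)} {p : M}

lemma jacobianFunction_eq (f ν : M → Euc (m + 1)) (p : M) (u : Euc m) :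
    jacobianFunction f ν p u = (jacobianMatrix (fderiv ℝ (f ∘ (chartAt (Euc m) p).symm) u)
      (ν ((chartAt (Euc m) p).symm u))).det := rfl

lemma injective_fderiv_comp_iff {N : ℕ} {f : M → Euc N} {Φ : Euc m → M} {y : Euc m}
    (hf : MDifferentiableAt (𝓡 m) (𝓡 N) f (Φ y)) (hΦ : MDifferentiableAt (𝓡 m) (𝓡 m) Φ y)
    (hinj : Function.Injective (mfderiv (𝓡 m) (𝓡 m) Φ y)) :
    Function.Injective (fderiv ℝ (f ∘ Φ) y) ↔
      Function.Injective (mfderiv (𝓡 m) (𝓡 N) f (Φ y)) := by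
  have hsurj : Function.Surjective (mfderiv (𝓡 m) (𝓡 m) Φ y) := by
    obtain ⟨e, he⟩ := exists_equiv_of_injective (A := mfderiv (𝓡 m) (𝓡 m) Φ y) hinj
    rw [← he]
    exact e.surjective
  have hcomp : (fderiv ℝ (f ∘ Φ) y : Euc m → Euc N) =
      (mfderiv (𝓡 m) (𝓡 N) f (Φ y)) ∘ (mfderiv (𝓡 m) (𝓡 m) Φ y) :=
    funext fun V => fderiv_comp_mfderiv hf hΦ V
  rw [hcomp]
  exact Function.Injective.of_comp_iff' _ ⟨hinj, hsurj⟩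

variable [IsManifold (𝓡 m) ∞ M]

lemma isManifold_one : IsManifold (𝓡 m) 1 M := IsManifold.of_le (n := ∞) (by norm_cast)

lemma contDiffOn_comp_chart_symm {N : ℕ} {g : M → Euc N} {U : Set M}
    (hg : ContMDiffOn (𝓡 m) (𝓡 N) ∞ g U) :
    ContDiffOn ℝ ∞ (g ∘ (chartAt (Euc m) p).symm)
      ((chartAt (Euc m) p).target ∩ (chartAt (Euc m) p).symm ⁻¹' U) := by
  rw [← contMDiffOn_iff_contDiffOn]
  exact hg.comp (contMDiffOn_chart_symm.mono Set.inter_subset_left) fun x hx => hx.2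

lemma mdifferentiableAt_chart_symm {u : Euc m} (hu : u ∈ (chartAt (Euc m) p).target) :
    MDifferentiableAt (𝓡 m) (𝓡 m) (chartAt (Euc m) p).symm u :=
  haveI := isManifold_one (m := m) (M := M)
  (mdifferentiable_chart (I := 𝓡 m) p).mdifferentiableAt_symm hu

lemma injective_mfderiv_chart_symm {u : Euc m} (hu : u ∈ (chartAt (Euc m) p).target) :
    Function.Injective (mfderiv (𝓡 m) (𝓡 m) (chartAt (Euc m) p).symm u) :=
  haveI := isManifold_one (m := m) (M := M)
  (mdifferentiable_chart (I := 𝓡 m) p).symm.mfderiv_injective hu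

lemma jacobianFunction_eq_zero_iff {U : Set M} (hf : ContMDiff (𝓡 m) (𝓡 (m + 1)) ∞ f)
    (hν : IsUnitNormal f ν U) {u : Euc m} (hu : u ∈ (chartAt (Euc m) p).target)
    (huU : (chartAt (Euc m) p).symm u ∈ U) :
    jacobianFunction f ν p u = 0 ↔ (chartAt (Euc m) p).symm u ∈ singularSet f := by
  have hfd := hf.mdifferentiable (by simp)
  rw [jacobianFunction_eq, det_jacobianMatrix_eq_zero_iff (hν.unit _ huU),
    injective_fderiv_comp_iff (hfd _) (mdifferentiableAt_chart_symm hu)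
      (injective_mfderiv_chart_symm hu)]
  · rfl
  · intro X
    rw [fderiv_comp_mfderiv (hfd _) (mdifferentiableAt_chart_symm hu)]
    exact hν.normal _ huU _

lemma contDiffAt_jacobianFunction {U : Set M} (hU : IsOpen U)
    (hf : ContMDiff (𝓡 m) (𝓡 (m + 1)) ∞ f)
    (hν : IsUnitNormal f ν U) {u : Euc m} (hu : u ∈ (chartAt (Euc m) p).target)
    (huU : (chartAt (Euc m) p).symm u ∈ U) :
    ContDiffAt ℝ ∞ (jacobianFunction f ν p) u := by
  have hopen : IsOpen ((chartAt (Euc m) p).target ∩ (chartAt (Euc m) p).symm ⁻¹' U) :=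
    (chartAt (Euc m) p).isOpen_inter_preimage_symm hU
  have hν' := (contDiffOn_comp_chart_symm (p := p) hν.smooth).contDiffAt
    (hopen.mem_nhds ⟨hu, huU⟩)
  have hf' := (contDiffOn_comp_chart_symm (p := p) (hf.contMDiffOn (s := U))).contDiffAt
    (hopen.mem_nhds ⟨hu, huU⟩)
  have hdf := hf'.fderiv_right (m := ∞) (by norm_cast)
  refine contDiffAt_matrix_det fun i j => ?_
  refine Fin.lastCases ?_ (fun a => ?_) i
  · simp only [Matrix.of_apply, Fin.snoc_last]
    exact contDiffAt_euclidean.1 hν' j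
  · simp only [Matrix.of_apply, Fin.snoc_castSucc]
    exact contDiffAt_euclidean.1 (hdf.clm_apply contDiffAt_const) j

end Chart

/-! ### The singular set is a submanifold -/

/-- Project onto the kernel of `l` along a complement and identify the kernel with `ℝᵏ`. The pair
`(L, l)` is then injective and can serve as a coordinate system with last coordinate `l`. -/
lemma exists_complementary_projection {k : ℕ} {l : Euc (k + 1) →L[ℝ] ℝ} (hl : l ≠ 0) :
    ∃ L : Euc (k + 1) →L[ℝ] Euc k, ∀ x, L x = 0 → l x = 0 → x = 0 := by
  have hl' : l.toLinearMap ≠ 0 := fun h => hl (by ext x; exact congrArg (fun g => g x) h)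
  have hfr : Module.finrank ℝ (LinearMap.ker l.toLinearMap) = k := by
    have h1 := LinearMap.finrank_range_add_finrank_ker l.toLinearMap
    rw [LinearMap.range_eq_top.2 (LinearMap.surjective hl'), finrank_top,
      finrank_euclideanSpace_fin, Module.finrank_self] at h1
    omega
  obtain ⟨P, hP⟩ := (LinearMap.ker l.toLinearMap).exists_isCompl
  have e : LinearMap.ker l.toLinearMap ≃ₗ[ℝ] Euc k :=
    LinearEquiv.ofFinrankEq _ _ (by rw [hfr, finrank_euclideanSpace_fin])
  refine ⟨LinearMap.toContinuousLinearMap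
    (e.toLinearMap ∘ₗ (LinearMap.ker l.toLinearMap).projectionOnto P hP), fun x hx hx' => ?_⟩
  have h1 : (LinearMap.ker l.toLinearMap).projectionOnto P hP x = 0 := by
    simpa using hx
  have h2 := Submodule.projectionOnto_apply_left hP (⟨x, hx'⟩ : LinearMap.ker l.toLinearMap)
  rw [h1] at h2
  exact (congrArg Subtype.val h2).symm

section Submanifold

variable {k : ℕ} {M : Type*} [TopologicalSpace M] [ChartedSpace (Euc (k + 1)) M]
  [IsManifold (𝓡 (k + 1)) ∞ M] {f : M → Euc (k + 1 + 1)} {p : M}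

/-- Since `dλ ≠ 0`, the function `λ` can be completed by a linear map `L` to a local diffeomorphism
`(L, λ)`. Its inverse on `λ = 0` parametrizes the singular set. -/
lemma exists_isLocalParam_of_isNonDegenerate (hf : ContMDiff (𝓡 (k + 1)) (𝓡 (k + 1 + 1)) ∞ f)
    (hp : IsNonDegenerate f p) :
    ∃ (W : Set (Euc k)) (γ : Euc k → M),
      IsLocalParam (k + 1) k (singularSet f) W γ ∧ p ∈ γ '' W := by
  obtain ⟨hps, U, ν, hU, hpU, hν, hd⟩ := hp
  set φ := chartAt (Euc (k + 1)) p with hφ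
  set E := φ.target ∩ φ.symm ⁻¹' U with hE
  have hEo : IsOpen E := φ.isOpen_inter_preimage_symm hU
  set J := jacobianFunction f ν p with hJ
  have hd' : fderiv ℝ J (φ p) ≠ 0 := hd
  have hpE : φ p ∈ E := ⟨φ.map_source (mem_chart_source _ p), by
    simp only [Set.mem_preimage]; rwa [φ.left_inv (mem_chart_source _ p)]⟩
  have hJs : ∀ u ∈ E, ContDiffAt ℝ ∞ J u := fun u hu =>
    contDiffAt_jacobianFunction hU hf hν hu.1 hu.2
  obtain ⟨L, hL⟩ := exists_complementary_projection hd'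
  set Ψ : Euc (k + 1) → Euc (k + 1) := fun u => incl k (L u) + J u • vert k with hΨ
  have hΨs : ContDiffOn ℝ ∞ Ψ E := fun u hu =>
    (((incl k).contDiff.contDiffAt.comp u L.contDiff.contDiffAt).add
      ((hJs u hu).smul contDiffAt_const)).contDiffWithinAt
  have hΨd : ∀ V, fderiv ℝ Ψ (φ p) V = incl k (L V) + fderiv ℝ J (φ p) V • vert k := by
    intro V
    have h1 : HasFDerivAt (fun u => incl k (L u)) ((incl k).comp L) (φ p) :=
      ((incl k).comp L).hasFDerivAt
    have h2 := ((hJs _ hpE).differentiableAt (by simp)).hasFDerivAt.smul_const (vert k)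
    have h3 := (h1.add h2).fderiv
    have h4 : fderiv ℝ Ψ (φ p) = _ := h3
    rw [h4]
    simp
  obtain ⟨e, hpe, heE, heΨ, -, hsymm⟩ := exists_local_diffeo hEo hΨs hpE (by
    refine (injective_iff_map_eq_zero _).2 fun V hV => ?_
    rw [hΨd] at hV
    refine hL V ?_ ?_
    · simpa using congrArg (horiz k) hV
    · simpa using congrArg (height k) hV)
  have hheight : ∀ u, height k (Ψ u) = J u := fun u => by simp [hΨ]
  have hsing : ∀ u ∈ e.source, J u = 0 ↔ φ.symm u ∈ singularSet f := fun u hu =>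
    jacobianFunction_eq_zero_iff hf hν (heE hu).1 (heE hu).2
  set W : Set (Euc k) := incl k ⁻¹' e.target with hW
  have hsrc : ∀ x ∈ W, e.symm (incl k x) ∈ e.source := fun x hx => e.map_target hx
  have hcontφ : ∀ x ∈ W, φ (φ.symm (e.symm (incl k x))) = e.symm (incl k x) := fun x hx =>
    φ.right_inv (heE (hsrc x hx)).1
  refine ⟨W, fun x => φ.symm (e.symm (incl k x)), IsLocalParam.of_leftInverse
    (h := fun q => horiz k (Ψ (φ q))) (e.open_target.preimage (incl k).continuous) ?_ ?_ ?_ ?_, ?_⟩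
  · refine (contMDiffOn_chart_symm (x := p) (n := ∞) (I := 𝓡 (k + 1))).comp (t := φ.target)
      (f := fun x => e.symm (incl k x)) (s := W) ?_ fun x hx => (heE (hsrc x hx)).1
    rw [contMDiffOn_iff_contDiffOn]
    exact hsymm.comp (incl k).contDiff.contDiffOn fun x hx => hx
  · intro x hx
    have h1 : MDifferentiableAt (𝓡 (k + 1)) (𝓡 (k + 1)) φ (φ.symm (e.symm (incl k x))) :=
      haveI := isManifold_one (m := k + 1) (M := M)
      (mdifferentiable_chart (I := 𝓡 (k + 1)) p).mdifferentiableAt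
        (φ.map_target (heE (hsrc x hx)).1)
    have h2 : MDifferentiableAt (𝓡 (k + 1)) (𝓡 k) (fun u => horiz k (Ψ u))
        (φ (φ.symm (e.symm (incl k x)))) := by
      rw [hcontφ x hx]
      refine DifferentiableAt.mdifferentiableAt ?_
      exact (horiz k).differentiableAt.comp _ ((hΨs.contDiffAt
        (hEo.mem_nhds (heE (hsrc x hx)))).differentiableAt (by simp))
    exact MDifferentiableAt.comp (g := fun u => horiz k (Ψ u)) _ h2 h1
  · intro x hx
    rw [hcontφ x hx, ← heΨ, e.right_inv hx, horiz_incl]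
  · refine ⟨φ.source ∩ φ ⁻¹' e.source, φ.isOpen_inter_preimage e.open_source, ?_⟩
    ext q
    constructor
    · rintro ⟨x, hx, rfl⟩
      refine ⟨(hsing _ (hsrc x hx)).1 ?_, φ.map_target (heE (hsrc x hx)).1, ?_⟩
      · rw [← hheight, ← heΨ, e.right_inv hx, height_incl]
      · simp only [Set.mem_preimage]
        rw [hcontφ x hx]
        exact hsrc x hx
    · rintro ⟨hq, hqs, hqe⟩
      have hJ0 : J (φ q) = 0 := (hsing _ hqe).2 (by rwa [φ.left_inv hqs])
      have hincl : incl k (L (φ q)) = e (φ q) := by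
        rw [heΨ, hΨ]
        simp [hJ0]
      refine ⟨L (φ q), ?_, ?_⟩
      · simp only [hW, Set.mem_preimage]
        rw [hincl]
        exact e.map_source hqe
      · simp only
        rw [hincl, e.left_inv hqe, φ.left_inv hqs]
  · have hJ0 : J (φ p) = 0 := (hsing _ hpe).2 (by rwa [φ.left_inv (mem_chart_source _ p)])
    have hincl : incl k (L (φ p)) = e (φ p) := by
      rw [heΨ, hΨ]
      simp [hJ0]
    refine ⟨L (φ p), ?_, ?_⟩
    · simp only [hW, Set.mem_preimage]
      rw [hincl]
      exact e.map_source hpe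
    · simp only
      rw [hincl, e.left_inv hpe, φ.left_inv (mem_chart_source _ p)]

end Submanifold

/-! ### Adapted coordinates -/

section NullField

variable {k N : ℕ} {g : Euc (k + 1) → Euc N} {D : Set (Euc (k + 1))} {c : Euc k → Euc (k + 1)}
  {W : Set (Euc k)} {w : Euc k} {η : Euc (k + 1)}

/-- A null vector at a point of a parametrized hypersurface of singular points, transversal to
the null directions, extends to a smooth null field along the hypersurface. -/
lemma exists_null_field (hD : IsOpen D) (hg : ContDiffOn ℝ ∞ g D) (hW : IsOpen W)
    (hc : ContDiffOn ℝ ∞ c W) (hcD : Set.MapsTo c W D) (hw : w ∈ W)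
    (hη : fderiv ℝ g (c w) η = 0)
    (hcompl : ∀ x ∈ W, ∀ v, ∃ b, fderiv ℝ g (c x) v = fderiv ℝ g (c x) (fderiv ℝ c x b))
    (himm : Function.Injective fun X => fderiv ℝ g (c w) (fderiv ℝ c w X)) :
    ∃ (V : Set (Euc k)) (ξ : Euc k → Euc (k + 1)), IsOpen V ∧ w ∈ V ∧ V ⊆ W ∧
      ContDiffOn ℝ ∞ ξ V ∧ ξ w = η ∧ ∀ x ∈ V, fderiv ℝ g (c x) (ξ x) = 0 := by
  set A : Euc k → Euc k →L[ℝ] Euc N := fun x => (fderiv ℝ g (c x)).comp (fderiv ℝ c x) with hA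
  obtain ⟨L', hL'⟩ := LinearMap.exists_leftInverse_of_injective (A w).toLinearMap
    (LinearMap.ker_eq_bot.2 himm)
  set L : Euc N →L[ℝ] Euc k := LinearMap.toContinuousLinearMap L' with hL
  have hLA : ∀ X, L (A w X) = X := fun X => congrArg (fun l => l X) hL'
  have hcs : ∀ x ∈ W, ContDiffAt ℝ ∞ c x := fun x hx => hc.contDiffAt (hW.mem_nhds hx)
  have hdc : ∀ x ∈ W, ContDiffAt ℝ ∞ (fderiv ℝ c) x := fun x hx =>
    (hcs x hx).fderiv_right (by norm_cast)
  have hdg : ∀ x ∈ W, ContDiffAt ℝ ∞ (fun x => fderiv ℝ g (c x)) x := fun x hx =>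
    ((hg.contDiffAt (hD.mem_nhds (hcD hx))).fderiv_right (m := ∞) (by norm_cast)).comp x
      (hcs x hx)
  -- `L` is a left inverse of `d(g ∘ c)` at `w`, so `T` is the identity at `w` and remains
  -- invertible nearby.
  set T : Euc k → Euc k →L[ℝ] Euc k := fun x => L.comp (A x) with hT
  have hTs : ∀ x ∈ W, ContDiffAt ℝ ∞ T x := fun x hx =>
    contDiffAt_const.clm_comp ((hdg x hx).clm_comp (hdc x hx))
  set V : Set (Euc k) := {x | x ∈ W ∧ Function.Injective (T x)} with hV
  -- Subtract from the constant `η` the tangent vector `dc b` with the same image under `dg`. Such a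
  -- `b` exists by `hcompl`, and `T⁻¹ L` recovers it smoothly.
  refine ⟨V, fun x => η - fderiv ℝ c x ((T x).inverse (L (fderiv ℝ g (c x) η))), ?_, ?_,
    fun x hx => hx.1, ?_, ?_, ?_⟩
  · rw [isOpen_iff_mem_nhds]
    rintro x ⟨hx, hxi⟩
    filter_upwards [hW.mem_nhds hx, eventually_injective (hTs x hx).continuousAt hxi] with z h1 h2
    exact ⟨h1, h2⟩
  · refine ⟨hw, fun X Y hXY => ?_⟩
    have h1 : L (A w X) = L (A w Y) := hXY
    rwa [hLA, hLA] at h1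
  · rintro x ⟨hx, hxi⟩
    obtain ⟨e, he⟩ := exists_equiv_of_injective hxi
    have hinv : ContDiffAt ℝ ∞ (fun x => (T x).inverse) x := by
      refine ContDiffAt.comp (g := ContinuousLinearMap.inverse) x ?_ (hTs x hx)
      rw [← he]
      exact contDiffAt_map_inverse e
    exact (contDiffAt_const.sub ((hdc x hx).clm_apply (hinv.clm_apply
      (contDiffAt_const.clm_apply ((hdg x hx).clm_apply contDiffAt_const))))).contDiffWithinAt
  · simp [hη]
  · rintro x ⟨hx, hxi⟩
    obtain ⟨b, hb⟩ := hcompl x hx η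
    obtain ⟨e, he⟩ := exists_equiv_of_injective hxi
    have h1 : (T x).inverse (L (fderiv ℝ g (c x) η)) = b := by
      have h2 : L (fderiv ℝ g (c x) η) = e b := by
        rw [hb]
        exact congrArg (fun l : Euc k →L[ℝ] Euc k => l b) he.symm
      rw [h2, ← he, ContinuousLinearMap.inverse_equiv]
      simp
    simp only
    rw [h1, map_sub, ← hb, sub_self]

/-- Adapted coordinates `(x, t)`: the hypersurface is `t = 0`, and `∂ₜ` is a null field on it. -/
lemma exists_adapted_coordinates (hD : IsOpen D) (hg : ContDiffOn ℝ ∞ g D) (hW : IsOpen W)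
    (hc : ContDiffOn ℝ ∞ c W) (hcD : Set.MapsTo c W D) (hw : w ∈ W) (hη0 : η ≠ 0)
    (hη : fderiv ℝ g (c w) η = 0)
    (hcompl : ∀ x ∈ W, ∀ v, ∃ b, fderiv ℝ g (c x) v = fderiv ℝ g (c x) (fderiv ℝ c x b))
    (himm : Function.Injective fun X => fderiv ℝ g (c w) (fderiv ℝ c w X)) :
    ∃ e : OpenPartialHomeomorph (Euc (k + 1)) (Euc (k + 1)), incl k w ∈ e.source ∧
      Set.MapsTo e e.source D ∧ ContDiffOn ℝ ∞ e e.source ∧ ContDiffOn ℝ ∞ e.symm e.target ∧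
      (∀ y ∈ e.source, Function.Injective (fderiv ℝ e y)) ∧ (∀ x, e (incl k x) = c x) ∧
      (∀ t : ℝ, e (incl k w + t • vert k) = c w + t • η) ∧
      (∀ᶠ x in 𝓝 w, fderiv ℝ g (c x) (fderiv ℝ e (incl k x) (vert k)) = 0) ∧
      (∀ X, fderiv ℝ e (incl k w) (incl k X) = fderiv ℝ c w X) ∧
      fderiv ℝ e (incl k w) (vert k) = η := by
  obtain ⟨V, ξ, hV, hwV, hVW, hξ, hξw, hnull⟩ := exists_null_field hD hg hW hc hcD hw hη hcompl himm
  -- Straight segments along the null field. In particular the `t`-axis over `w` is the line through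
  -- `c w` with velocity `η`.
  set G : Euc (k + 1) → Euc (k + 1) := fun y => c (horiz k y) + height k y • ξ (horiz k y) with hG
  have hpre : IsOpen (horiz k ⁻¹' V) := hV.preimage (horiz k).continuous
  have hGs : ContDiffOn ℝ ∞ G (horiz k ⁻¹' V) :=
    ((hc.mono hVW).comp (horiz k).contDiff.contDiffOn fun y hy => hy).add
      ((height k).contDiff.contDiffOn.smul (hξ.comp (horiz k).contDiff.contDiffOn fun y hy => hy))
  have hGi : ∀ x, G (incl k x) = c x := fun x => by simp [hG]
  have hGd : ∀ x ∈ V, ∀ v, fderiv ℝ G (incl k x) v =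
      fderiv ℝ c x (horiz k v) + height k v • ξ x := by
    intro x hx v
    have h1 : HasFDerivAt c (fderiv ℝ c x) (horiz k (incl k x)) := by
      rw [horiz_incl]
      exact ((hc.contDiffAt (hW.mem_nhds (hVW hx))).differentiableAt (by simp)).hasFDerivAt
    have h2 : HasFDerivAt ξ (fderiv ℝ ξ x) (horiz k (incl k x)) := by
      rw [horiz_incl]
      exact ((hξ.contDiffAt (hV.mem_nhds hx)).differentiableAt (by simp)).hasFDerivAt
    have h3 := (h1.comp (incl k x) (horiz k).hasFDerivAt).add
      ((height k).hasFDerivAt.smul (h2.comp (incl k x) (horiz k).hasFDerivAt))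
    have h4 : fderiv ℝ G (incl k x) = _ := h3.fderiv
    rw [h4]
    simp
  set B := horiz k ⁻¹' V ∩ G ⁻¹' D with hB
  have hBo : IsOpen B := hGs.continuousOn.isOpen_inter_preimage hpre hD
  have hwB : incl k w ∈ B := by
    refine ⟨by simpa using hwV, ?_⟩
    simp only [Set.mem_preimage]
    rw [hGi]
    exact hcD hw
  obtain ⟨e, hwe, heB, heG, hinj, hsymm⟩ := exists_local_diffeo hBo (hGs.mono
    Set.inter_subset_left) hwB (by
      refine (injective_iff_map_eq_zero _).2 fun v hv => ?_
      rw [hGd w hwV, hξw] at hv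
      have h1 := congrArg (fderiv ℝ g (c w)) hv
      rw [map_add, map_smul, hη, smul_zero, add_zero, map_zero] at h1
      have h2 : horiz k v = 0 := himm (by simpa using h1)
      rw [h2, map_zero, zero_add, smul_eq_zero, or_iff_left hη0] at hv
      rw [← incl_horiz_add v, h2, hv]
      simp)
  refine ⟨e, hwe, fun y hy => by rw [heG]; exact (heB hy).2, ?_, hsymm, ?_, ?_, ?_, ?_, ?_, ?_⟩
  · rw [heG]
    exact hGs.mono fun y hy => (heB hy).1
  · rwa [heG]
  · rwa [heG]
  · intro t
    rw [heG]
    simp [hG, hξw]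
  · filter_upwards [hV.mem_nhds hwV] with x hx
    rw [heG, hGd x hx]
    simpa using hnull x hx
  · intro X
    rw [heG, hGd w hwV]
    simp
  · rw [heG, hGd w hwV]
    simp [hξw]

end NullField

/-! ### The second derivative of the front in the null direction -/

section Transversal

variable {m : ℕ} {M : Type*} [TopologicalSpace M] [ChartedSpace (Euc m) M]
  [IsManifold (𝓡 m) ∞ M] {f ν : M → Euc (m + 1)} {p : M} {U : Set M} {η : Euc m}

/-- Along the line `φ p + t • η` the Jacobian matrix has the left null vector `(η, 0)` at `t = 0`.
Its product with that vector has derivative `D²g(η, η)`, and its determinant has derivative `dλ(η)`.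
The vector `c` then comes from `exists_mulVec_eq_zero_of_deriv_det_ne_zero`, and the first `m` rows
make it normal to the image of `dg`. -/
lemma exists_normal_of_fderiv_jacobianFunction_ne_zero (hU : IsOpen U) (hpU : p ∈ U)
    (hf : ContMDiff (𝓡 m) (𝓡 (m + 1)) ∞ f) (hν : IsUnitNormal f ν U) (hη0 : η ≠ 0)
    (hη : fderiv ℝ (f ∘ (chartAt (Euc m) p).symm) (chartAt (Euc m) p p) η = 0)
    (hd : fderiv ℝ (jacobianFunction f ν p) (chartAt (Euc m) p p) η ≠ 0) :
    ∃ c : Euc (m + 1),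
      (∀ V, inner ℝ (fderiv ℝ (f ∘ (chartAt (Euc m) p).symm) (chartAt (Euc m) p p) V) c = 0) ∧
      inner ℝ (fderiv ℝ (fderiv ℝ (f ∘ (chartAt (Euc m) p).symm)) (chartAt (Euc m) p p) η η) c
        ≠ 0 := by
  set φ := chartAt (Euc m) p with hφ
  set g := f ∘ φ.symm with hg
  have hopen : IsOpen (φ.target ∩ φ.symm ⁻¹' U) := φ.isOpen_inter_preimage_symm hU
  have hmem : φ p ∈ φ.target ∩ φ.symm ⁻¹' U := ⟨φ.map_source (mem_chart_source _ p), by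
    simp only [Set.mem_preimage]; rwa [φ.left_inv (mem_chart_source _ p)]⟩
  have hν' : ContDiffAt ℝ ∞ (ν ∘ φ.symm) (φ p) :=
    (contDiffOn_comp_chart_symm (p := p) hν.smooth).contDiffAt (hopen.mem_nhds hmem)
  have hg' : ContDiffAt ℝ ∞ g (φ p) :=
    (contDiffOn_comp_chart_symm (p := p) (hf.contMDiffOn (s := U))).contDiffAt
      (hopen.mem_nhds hmem)
  have hdg : ContDiffAt ℝ ∞ (fderiv ℝ g) (φ p) := hg'.fderiv_right (by norm_cast)
  have hline : ContDiffAt ℝ 1 (fun t : ℝ => φ p + t • η) 0 :=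
    contDiffAt_const.add (contDiffAt_id.smul contDiffAt_const)
  have h0 : φ p + (0 : ℝ) • η = φ p := by simp
  set A : ℝ → Matrix (Fin (m + 1)) (Fin (m + 1)) ℝ := fun t =>
    jacobianMatrix (fderiv ℝ g (φ p + t • η)) ((ν ∘ φ.symm) (φ p + t • η)) with hA
  have hAs : ∀ i j, ContDiffAt ℝ 1 (fun t => A t i j) 0 := by
    intro i j
    have h1 : ContDiffAt ℝ 1 (fun t : ℝ => (ν ∘ φ.symm) (φ p + t • η)) 0 := by
      refine ContDiffAt.comp (g := ν ∘ φ.symm) (0 : ℝ) ?_ hline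
      rw [h0]; exact hν'.of_le (by norm_cast)
    have h2 : ContDiffAt ℝ 1 (fun t : ℝ => fderiv ℝ g (φ p + t • η)) 0 := by
      refine ContDiffAt.comp (0 : ℝ) ?_ hline
      rw [h0]; exact hdg.of_le (by norm_cast)
    refine Fin.lastCases ?_ (fun a => ?_) i
    · simp only [hA, jacobianMatrix, Matrix.of_apply, Fin.snoc_last]
      exact contDiffAt_euclidean.1 h1 j
    · simp only [hA, jacobianMatrix, Matrix.of_apply, Fin.snoc_castSucc]
      exact contDiffAt_euclidean.1 (h2.clm_apply contDiffAt_const) j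
  set x : Fin (m + 1) → ℝ := Fin.snoc (α := fun _ => ℝ) η.ofLp 0 with hx
  have hvec : ∀ t l, Matrix.vecMul x (A t) l = fderiv ℝ g (φ p + t • η) η l := by
    intro t l
    rw [hA, vecMul_jacobianMatrix]
    simp [hx]
  have hderiv : ∀ l, HasDerivAt (fun t => Matrix.vecMul x (A t) l)
      (fderiv ℝ (fderiv ℝ g) (φ p) η η l) 0 := by
    intro l
    simp only [hvec]
    have h1 := hasDerivAt_fderiv_line (v := η) (hg'.of_le (by norm_cast))
      (hasDerivAt_const (0 : ℝ) η)
    rw [map_zero, add_zero] at h1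
    exact (EuclideanSpace.proj (𝕜 := ℝ) l).hasFDerivAt.comp_hasDerivAt (0 : ℝ) h1
  have hdet : deriv (fun t => (A t).det) 0 = fderiv ℝ (jacobianFunction f ν p) (φ p) η := by
    have h1 : HasFDerivAt (jacobianFunction f ν p) (fderiv ℝ (jacobianFunction f ν p) (φ p))
        (φ p + (0 : ℝ) • η) := by
      rw [h0]
      exact ((contDiffAt_jacobianFunction hU hf hν hmem.1 hmem.2).differentiableAt
        (by simp)).hasFDerivAt
    exact (h1.comp_hasDerivAt (0 : ℝ) (hasDerivAt_line (φ p) η)).deriv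
  obtain ⟨c, hc, hc'⟩ := exists_mulVec_eq_zero_of_deriv_det_ne_zero hAs (x := x)
    (fun h => hη0 (by ext a; simpa [hx] using congrFun h a.castSucc))
    (by ext l; rw [hvec, h0, hη]; rfl) hderiv (by rwa [hdet])
  refine ⟨WithLp.toLp 2 c, fun V => ?_, ?_⟩
  · rw [map_eq_sum, sum_inner]
    refine Finset.sum_eq_zero fun a _ => ?_
    have h1 := congrFun hc a.castSucc
    rw [hA, mulVec_jacobianMatrix_castSucc, h0] at h1
    rw [inner_smul_left, h1]
    simp
  · simpa [PiLp.inner_apply, mul_comm] using hc'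

end Transversal

/-! ### Adapted coordinates along a parametrized singular set -/

section Singular

variable {k : ℕ} {M : Type*} [TopologicalSpace M] [ChartedSpace (Euc (k + 1)) M]
  {f : M → Euc (k + 1 + 1)} {W : Set (Euc k)} {γ : Euc k → M} {w : Euc k}

lemma IsLocalParam.mem {m n : ℕ} {M : Type*} [TopologicalSpace M] [ChartedSpace (Euc m) M]
    {S : Set M} {W : Set (Euc n)} {γ : Euc n → M} (hγ : IsLocalParam m n S W γ) {x : Euc n}
    (hx : x ∈ W) : γ x ∈ S := by
  obtain ⟨O, -, hO⟩ := hγ.image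
  have : γ x ∈ S ∩ O := hO ▸ Set.mem_image_of_mem γ hx
  exact this.1

lemma IsLocalParam.mdifferentiableAt {m n : ℕ} {M : Type*} [TopologicalSpace M]
    [ChartedSpace (Euc m) M] {S : Set M} {W : Set (Euc n)} {γ : Euc n → M}
    (hγ : IsLocalParam m n S W γ) {x : Euc n} (hx : x ∈ W) :
    MDifferentiableAt (𝓡 n) (𝓡 m) γ x :=
  (hγ.smooth.contMDiffAt (hγ.isOpen.mem_nhds hx)).mdifferentiableAt (by simp)

/-- The null direction meets the tangent space of the singular set only in zero. -/
lemma injective_fderiv_comp_param (hf : ContMDiff (𝓡 (k + 1)) (𝓡 (k + 1 + 1)) ∞ f)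
    (hA : ∀ p ∈ singularSet f, IsA2Point f p)
    (hγ : IsLocalParam (k + 1) k (singularSet f) W γ) (hw : w ∈ W) :
    Function.Injective (fderiv ℝ (f ∘ γ) w) := by
  have hcompl := (hA _ (hγ.mem hw)).2 W γ hγ w hw rfl
  refine (injective_iff_map_eq_zero _).2 fun X hX => ?_
  rw [fderiv_comp_mfderiv (hf.mdifferentiable (by simp) _) (hγ.mdifferentiableAt hw)] at hX
  have h1 : mfderiv (𝓡 k) (𝓡 (k + 1)) γ w X = 0 :=
    (Submodule.disjoint_def.1 hcompl.disjoint) _ hX ⟨X, rfl⟩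
  exact hγ.immersion w hw (h1.trans (map_zero _).symm)

/-- Modulo the kernel of `df`, every tangent vector is tangent to the singular set. -/
lemma exists_fderiv_comp_param_eq (hf : ContMDiff (𝓡 (k + 1)) (𝓡 (k + 1 + 1)) ∞ f)
    (hA : ∀ p ∈ singularSet f, IsA2Point f p)
    (hγ : IsLocalParam (k + 1) k (singularSet f) W γ) (hw : w ∈ W)
    (v : TangentSpace (𝓡 (k + 1)) (γ w)) :
    ∃ b, mfderiv (𝓡 (k + 1)) (𝓡 (k + 1 + 1)) f (γ w) v = fderiv ℝ (f ∘ γ) w b := by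
  have hcompl := (hA _ (hγ.mem hw)).2 W γ hγ w hw rfl
  have hv : v ∈ (⊤ : Submodule ℝ (TangentSpace (𝓡 (k + 1)) (γ w))) := Submodule.mem_top
  rw [← hcompl.sup_eq_top, Submodule.mem_sup] at hv
  obtain ⟨y, hy, _, ⟨b, rfl⟩, rfl⟩ := hv
  refine ⟨b, ?_⟩
  have hy' : mfderiv (𝓡 (k + 1)) (𝓡 (k + 1 + 1)) f (γ w) y = 0 := hy
  rw [map_add, hy', zero_add]
  exact (fderiv_comp_mfderiv (hf.mdifferentiable (by simp) _) (hγ.mdifferentiableAt hw) b).symm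

variable [IsManifold (𝓡 (k + 1)) ∞ M]

lemma mdifferentiableAt_chart {p q : M} (hq : q ∈ (chartAt (Euc (k + 1)) p).source) :
    MDifferentiableAt (𝓡 (k + 1)) (𝓡 (k + 1)) (chartAt (Euc (k + 1)) p) q :=
  haveI := isManifold_one (m := k + 1) (M := M)
  (mdifferentiable_chart (I := 𝓡 (k + 1)) p).mdifferentiableAt hq

lemma mfderiv_eq_fderiv_chart {N : ℕ} {g : M → Euc N} {p q : M}
    (hq : q ∈ (chartAt (Euc (k + 1)) p).source)
    (hg : MDifferentiableAt (𝓡 (k + 1)) (𝓡 N) g q) (v : TangentSpace (𝓡 (k + 1)) q) :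
    mfderiv (𝓡 (k + 1)) (𝓡 N) g q v =
      fderiv ℝ (g ∘ (chartAt (Euc (k + 1)) p).symm) (chartAt (Euc (k + 1)) p q)
        (mfderiv (𝓡 (k + 1)) (𝓡 (k + 1)) (chartAt (Euc (k + 1)) p) q v) := by
  have := isManifold_one (m := k + 1) (M := M)
  set φ := chartAt (Euc (k + 1)) p with hφ
  have hleft : φ.symm (φ q) = q := φ.left_inv hq
  have h0 := fderiv_comp_mfderiv (f := g) (γ := φ.symm) (x := φ q) (by rwa [hleft])
    (mdifferentiableAt_chart_symm (φ.map_source hq))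
    (mfderiv (𝓡 (k + 1)) (𝓡 (k + 1)) φ q v : Euc (k + 1))
  have h1 := (mdifferentiable_chart (I := 𝓡 (k + 1)) p).symm_comp_deriv hq
  have h2 : mfderiv (𝓡 (k + 1)) (𝓡 (k + 1)) φ.symm (φ q)
      (mfderiv (𝓡 (k + 1)) (𝓡 (k + 1)) φ q v) = v :=
    congrArg (fun l : TangentSpace (𝓡 (k + 1)) q →L[ℝ] TangentSpace (𝓡 (k + 1)) q => l v) h1
  refine Eq.trans ?_ h0.symm
  rw [h2, hleft]

/-- Near a point of the singular set consisting of `A₂`-points there are coordinates `Φ` with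
`∂ₜΦ = η` at the point, in which a curvature bound on the regular set along the `t`-axis is
inherited by the singular set. -/
theorem exists_coordinates_at_singular (hf : IsFront f)
    (hA : ∀ p ∈ singularSet f, IsA2Point f p)
    (hγ : IsLocalParam (k + 1) k (singularSet f) W γ) (hw : w ∈ W) {η : Euc (k + 1)}
    (hη0 : η ≠ 0)
    (hη : fderiv ℝ (f ∘ (chartAt (Euc (k + 1)) (γ w)).symm)
      (chartAt (Euc (k + 1)) (γ w) (γ w)) η = 0) :
    ∃ (B : Set (Euc (k + 1))) (Φ : Euc (k + 1) → M), IsOpen B ∧ incl k w ∈ B ∧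
      ContMDiffOn (𝓡 (k + 1)) (𝓡 (k + 1)) ∞ Φ B ∧
      Set.MapsTo Φ B (chartAt (Euc (k + 1)) (γ w)).source ∧
      (∀ y ∈ B, Function.Injective (fderiv ℝ (chartAt (Euc (k + 1)) (γ w) ∘ Φ) y)) ∧
      Φ (incl k w) = γ w ∧
      fderiv ℝ (chartAt (Euc (k + 1)) (γ w) ∘ Φ) (incl k w) (vert k) = η ∧
      IsLocalParam (k + 1) (k + 1) (singularSet f)ᶜ (B ∩ Φ ⁻¹' (singularSet f)ᶜ) Φ ∧
      (∀ᶠ t in 𝓝[≠] (0 : ℝ), Φ (incl k w + t • vert k) ∈ (singularSet f)ᶜ) ∧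
      ∀ (Z : ℝ → Euc (k + 1)) (δ : ℝ), DifferentiableAt ℝ Z 0 → Z 0 = vert k → 0 ≤ δ →
        (∀ X ≠ 0, ∀ᶠ t in 𝓝[≠] (0 : ℝ), δ ≤
          sectionalCurvature (pullbackMetric (f ∘ Φ)) (incl k w + t • vert k) (incl k X) (Z t)) →
        ∀ X Y : Euc k, LinearIndependent ℝ ![X, Y] →
          0 ≤ sectionalCurvature (pullbackMetric (f ∘ γ)) w X Y ∧
          (0 < δ → 0 < sectionalCurvature (pullbackMetric (f ∘ γ)) w X Y) := by
  obtain ⟨hfs, hfν⟩ := hf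
  have hfd := hfs.mdifferentiable (by simp)
  set p := γ w with hp
  have hps : p ∈ singularSet f := hγ.mem hw
  set φ := chartAt (Euc (k + 1)) p with hφ
  set g := f ∘ φ.symm with hg
  set c := φ ∘ γ with hc
  set W' := W ∩ γ ⁻¹' φ.source with hW'
  have hW'o : IsOpen W' := hγ.smooth.continuousOn.isOpen_inter_preimage hγ.isOpen φ.open_source
  have hwW' : w ∈ W' := ⟨hw, mem_chart_source _ p⟩
  have hcs : ContDiffOn ℝ ∞ c W' := by
    rw [← contMDiffOn_iff_contDiffOn]
    exact (contMDiffOn_chart (x := p) (n := ∞) (I := 𝓡 (k + 1))).comp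
      (hγ.smooth.mono Set.inter_subset_left) fun x hx => hx.2
  have hgs : ContDiffOn ℝ ∞ g φ.target := by
    have := contDiffOn_comp_chart_symm (p := p) (hfs.contMDiffOn (s := Set.univ))
    simpa using this
  have hgat : ∀ u ∈ φ.target, ContDiffAt ℝ ∞ g u := fun u hu =>
    hgs.contDiffAt (φ.open_target.mem_nhds hu)
  have hcat : ∀ x ∈ W', ContDiffAt ℝ ∞ c x := fun x hx => hcs.contDiffAt (hW'o.mem_nhds hx)
  have hcD : Set.MapsTo c W' φ.target := fun x hx => φ.map_source hx.2
  have hgc : ∀ x ∈ W', f ∘ γ =ᶠ[𝓝 x] g ∘ c := fun x hx => by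
    filter_upwards [hW'o.mem_nhds hx] with z hz
    simp only [hg, hc, Function.comp_apply, φ.left_inv hz.2]
  have hdgc : ∀ x ∈ W', ∀ b, fderiv ℝ (f ∘ γ) x b = fderiv ℝ g (c x) (fderiv ℝ c x b) := by
    intro x hx b
    rw [(hgc x hx).fderiv_eq, fderiv_comp x ((hgat _ (hcD hx)).differentiableAt (by simp))
      ((hcat x hx).differentiableAt (by simp))]
    rfl
  have himm : Function.Injective fun X => fderiv ℝ g (c w) (fderiv ℝ c w X) := by
    have h1 := injective_fderiv_comp_param hfs hA hγ hw
    intro X Y hXY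
    refine h1 ?_
    rw [hdgc w hwW', hdgc w hwW']
    exact hXY
  have hcompl : ∀ x ∈ W', ∀ v, ∃ b, fderiv ℝ g (c x) v = fderiv ℝ g (c x) (fderiv ℝ c x b) := by
    intro x hx v
    have hleft : φ.symm (c x) = γ x := φ.left_inv hx.2
    have h1 : fderiv ℝ g (c x) v = _ :=
      fderiv_comp_mfderiv (hfd _) (mdifferentiableAt_chart_symm (hcD hx)) v
    obtain ⟨b, hb⟩ := exists_fderiv_comp_param_eq hfs hA hγ hx.1
      (mfderiv (𝓡 (k + 1)) (𝓡 (k + 1)) φ.symm (c x) v : Euc (k + 1))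
    refine ⟨b, ?_⟩
    rw [← hdgc x hx, ← hb, h1, hleft]
  obtain ⟨e, hwe, heD, hes, hesymm, heinj, hei, het, henull, heX, hev⟩ :=
    exists_adapted_coordinates φ.open_target hgs hW'o hcs hcD hwW' hη0 hη hcompl himm
  set Φ : Euc (k + 1) → M := φ.symm ∘ e with hΦ
  have hφΦ : ∀ y ∈ e.source, φ (Φ y) = e y := fun y hy => φ.right_inv (heD hy)
  have hφΦev : ∀ y ∈ e.source, φ ∘ Φ =ᶠ[𝓝 y] e := fun y hy => by
    filter_upwards [e.open_source.mem_nhds hy] with z hz using hφΦ z hz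
  have hΦw : Φ (incl k w) = p := by
    simp only [hΦ, Function.comp_apply, hei]
    exact φ.left_inv (mem_chart_source _ p)
  have hΦs : ContMDiffOn (𝓡 (k + 1)) (𝓡 (k + 1)) ∞ Φ e.source :=
    (contMDiffOn_chart_symm (x := p) (n := ∞) (I := 𝓡 (k + 1))).comp
      (contMDiffOn_iff_contDiffOn.2 hes) heD
  have hΦat : ∀ y ∈ e.source, ContMDiffAt (𝓡 (k + 1)) (𝓡 (k + 1)) ∞ Φ y := fun y hy =>
    hΦs.contMDiffAt (e.open_source.mem_nhds hy)
  have hΦd : ∀ y ∈ e.source, MDifferentiableAt (𝓡 (k + 1)) (𝓡 (k + 1)) Φ y := fun y hy =>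
    (hΦat y hy).mdifferentiableAt (by simp)
  have hΦsrc : Set.MapsTo Φ e.source φ.source := fun y hy => φ.map_target (heD hy)
  have hΦinj : ∀ y ∈ e.source, Function.Injective (mfderiv (𝓡 (k + 1)) (𝓡 (k + 1)) Φ y) := by
    intro y hy V V' hVV'
    have h1 := fderiv_comp_mfderiv (mdifferentiableAt_chart (hΦsrc hy)) (hΦd y hy)
    refine heinj y hy ?_
    rw [← (hφΦev y hy).fderiv_eq]
    refine (h1 V).trans (Eq.trans ?_ (h1 V').symm)
    rw [hVV']
  set F := f ∘ Φ with hF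
  have hFs : ∀ y ∈ e.source, ContDiffAt ℝ ∞ F y := fun y hy => by
    rw [← contMDiffAt_iff_contDiffAt]
    exact hfs.contMDiffAt.comp y (hΦat y hy)
  have hFg : F = g ∘ e := rfl
  have hsing : ∀ y ∈ e.source, Φ y ∈ (singularSet f)ᶜ ↔ Function.Injective (fderiv ℝ F y) := by
    intro y hy
    rw [hF, injective_fderiv_comp_iff (hfd _) (hΦd y hy) (hΦinj y hy)]
    simp [singularSet]
  have hdF : ∀ y ∈ e.source, ∀ v, fderiv ℝ F y v = fderiv ℝ g (e y) (fderiv ℝ e y v) := by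
    intro y hy v
    rw [hFg, fderiv_comp y ((hgat _ (heD hy)).differentiableAt (by simp))
      ((hes.contDiffAt (e.open_source.mem_nhds hy)).differentiableAt (by simp))]
    rfl
  set B' := e.source ∩ Φ ⁻¹' (singularSet f)ᶜ with hB'
  have hB'o : IsOpen B' := by
    rw [isOpen_iff_mem_nhds]
    rintro y ⟨hy, hyr⟩
    have hcont : ContinuousAt (fderiv ℝ F) y :=
      ((hFs y hy).fderiv_right (m := 1) (by norm_cast)).continuousAt
    filter_upwards [e.open_source.mem_nhds hy,
      eventually_injective hcont ((hsing y hy).1 hyr)] with z h1 h2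
    exact ⟨h1, (hsing z h1).2 h2⟩
  have hparam : IsLocalParam (k + 1) (k + 1) (singularSet f)ᶜ B' Φ := by
    refine IsLocalParam.of_leftInverse (h := e.symm ∘ φ) hB'o (hΦs.mono Set.inter_subset_left)
      ?_ ?_ ?_
    · intro y hy
      refine MDifferentiableAt.comp _ ?_ (mdifferentiableAt_chart (hΦsrc hy.1))
      rw [hφΦ y hy.1]
      exact ((hesymm.contDiffAt (e.open_target.mem_nhds
        (e.map_source hy.1))).differentiableAt (by simp)).mdifferentiableAt
    · intro y hy
      rw [Function.comp_apply, hφΦ y hy.1, e.left_inv hy.1]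
    · refine ⟨Φ '' B', ?_, ?_⟩
      · have h1 : (e.trans φ.symm) '' B' = Φ '' B' := rfl
        rw [← h1]
        refine (e.trans φ.symm).isOpen_image_of_subset_source hB'o fun y hy => ?_
        rw [OpenPartialHomeomorph.trans_source]
        exact ⟨hy.1, heD hy.1⟩
      · rw [eq_comm, Set.inter_eq_right]
        rintro _ ⟨y, hy, rfl⟩
        exact hy.2
  -- the Jacobian function vanishes to first order in the null direction
  obtain ⟨-, U', ν', hU', hpU', hν', hJd⟩ := (hA p hps).1
  have hJd' : fderiv ℝ (jacobianFunction f ν' p) (φ p) ≠ 0 := hJd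
  have hpt : φ p ∈ φ.target := φ.map_source (mem_chart_source _ p)
  have hpsymm : φ.symm (φ p) = p := φ.left_inv (mem_chart_source _ p)
  have hJs : DifferentiableAt ℝ (jacobianFunction f ν' p) (φ p) :=
    (contDiffAt_jacobianFunction hU' hfs hν' hpt (by rwa [hpsymm])).differentiableAt (by simp)
  -- `λ` vanishes on the singular set, so `dλ` kills its tangent space; as `dλ ≠ 0`, it cannot kill
  -- the complementary direction `η` too.
  have hJη : fderiv ℝ (jacobianFunction f ν' p) (φ p) η ≠ 0 := by
    intro h0
    apply hJd'
    have hJc : ∀ X, fderiv ℝ (jacobianFunction f ν' p) (φ p) (fderiv ℝ c w X) = 0 := by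
      intro X
      have hcont : ContinuousAt γ w := (hγ.mdifferentiableAt hw).continuousAt
      have heq : jacobianFunction f ν' p ∘ c =ᶠ[𝓝 w] fun _ => (0 : ℝ) := by
        filter_upwards [hW'o.mem_nhds hwW', hcont.preimage_mem_nhds (hU'.mem_nhds hpU')]
          with x hx hxU
        have hleft : φ.symm (c x) = γ x := φ.left_inv hx.2
        exact (jacobianFunction_eq_zero_iff hfs hν' (hcD hx) (hleft.symm ▸ hxU)).2
          (hleft.symm ▸ hγ.mem hx.1)
      have h1 := congrArg (fun L : Euc k →L[ℝ] ℝ => L X) heq.fderiv_eq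
      rw [fderiv_comp w hJs ((hcat w hwW').differentiableAt (by simp))] at h1
      simpa [show c w = φ p from rfl] using h1
    ext v
    obtain ⟨A, hAe⟩ := exists_equiv_of_injective (heinj _ hwe)
    obtain ⟨y, rfl⟩ := A.surjective v
    have h2 : A y = fderiv ℝ c w (horiz k y) + height k y • η := by
      rw [← heX, ← hev, ← map_smul, ← map_add, incl_horiz_add, ← hAe]
      rfl
    rw [h2, map_add, map_smul, hJc, h0]
    simp
  obtain ⟨n, hn, hn'⟩ :=
    exists_normal_of_fderiv_jacobianFunction_ne_zero hU' hpU' hfs hν' hη0 hη hJη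
  have hlineB : ∀ᶠ t in 𝓝 (0 : ℝ), incl k w + t • vert k ∈ e.source :=
    eventually_line (e.open_source.mem_nhds hwe) (vert k)
  -- In the chart the `t`-axis is the line `φ p + t • η`, along which `λ` has an isolated zero
  -- because `dλ(η) ≠ 0`.
  have hreg : ∀ᶠ t in 𝓝[≠] (0 : ℝ), Φ (incl k w + t • vert k) ∈ (singularSet f)ᶜ := by
    have hd : HasDerivAt (fun t : ℝ => jacobianFunction f ν' p (φ p + t • η))
        (fderiv ℝ (jacobianFunction f ν' p) (φ p) η) 0 := by
      have h1 : HasFDerivAt (jacobianFunction f ν' p)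
          (fderiv ℝ (jacobianFunction f ν' p) (φ p)) (φ p + (0 : ℝ) • η) := by
        rw [zero_smul, add_zero]
        exact hJs.hasFDerivAt
      exact h1.comp_hasDerivAt (0 : ℝ) (hasDerivAt_line (φ p) η)
    have hU'' : IsOpen (φ.target ∩ φ.symm ⁻¹' U') := φ.isOpen_inter_preimage_symm hU'
    have hmem : ∀ᶠ u in 𝓝 (φ p), u ∈ φ.target ∩ φ.symm ⁻¹' U' :=
      hU''.mem_nhds ⟨hpt, by simpa only [Set.mem_preimage, hpsymm] using hpU'⟩
    filter_upwards [hd.eventually_ne hJη, nhdsWithin_le_nhds (eventually_line hmem η)]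
      with t h1 h2 h3
    refine h1 ((jacobianFunction_eq_zero_iff hfs hν' h2.1 h2.2).2 ?_)
    have h4 : e (incl k w + t • vert k) = φ p + t • η := het t
    rw [← h4]
    exact h3
  refine ⟨e.source, Φ, e.open_source, hwe, hΦs, hΦsrc, ?_, hΦw, ?_, hparam, hreg, ?_⟩
  · intro y hy
    rw [(hφΦev y hy).fderiv_eq]
    exact heinj y hy
  · rw [(hφΦev _ hwe).fderiv_eq, hev]
  intro Z δ hZ hZ0 hδ hK X Y hXY
  obtain ⟨U, ν, hU, hpU, hν, himmν⟩ := hfν p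
  have hνat : ContMDiffAt (𝓡 (k + 1)) (𝓡 (k + 1 + 1)) ∞ ν (Φ (incl k w)) := by
    rw [hΦw]; exact hν.smooth.contMDiffAt (hU.mem_nhds hpU)
  have hUev : ∀ᶠ y in 𝓝 (incl k w), y ∈ e.source ∧ Φ y ∈ U := by
    have hcont : ContinuousAt Φ (incl k w) := (hΦat _ hwe).continuousAt
    filter_upwards [e.open_source.mem_nhds hwe,
      hcont.preimage_mem_nhds (hU.mem_nhds (by rwa [hΦw]))] with y h1 h2 using ⟨h1, h2⟩
  have hFv0 : fderiv ℝ F (incl k w) (vert k) = 0 := by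
    rw [hdF _ hwe, hev, hei]; exact hη
  -- The coordinate map is affine on the `t`-axis, so the second derivative picks up no first-order
  -- term.
  have hD2 : fderiv ℝ (fderiv ℝ F) (incl k w) (vert k) (vert k) =
      fderiv ℝ (fderiv ℝ g) (φ p) η η := by
    have h1 := hasDerivAt_fderiv_line (v := vert k) ((hFs _ hwe).of_le (m := 2) (by norm_cast))
      (hasDerivAt_const (0 : ℝ) (vert k))
    have h2 := hasDerivAt_fderiv_line (v := η) ((hgat _ hpt).of_le (m := 2) (by norm_cast))
      (hasDerivAt_const (0 : ℝ) η)
    have heq : (fun t : ℝ => fderiv ℝ F (incl k w + t • vert k) (vert k)) =ᶠ[𝓝 0]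
        fun t => fderiv ℝ g (φ p + t • η) η := by
      filter_upwards [hlineB] with t ht
      have h3 : fderiv ℝ e (incl k w + t • vert k) (vert k) = η := by
        have h4 : HasFDerivAt e (fderiv ℝ e (incl k w + t • vert k))
            (incl k w + t • vert k) :=
          ((hes.contDiffAt (e.open_source.mem_nhds ht)).differentiableAt (by simp)).hasFDerivAt
        have h5 : HasDerivAt (fun s : ℝ => incl k w + s • vert k) (vert k) t := by
          simpa using ((hasDerivAt_id t).smul_const (vert k)).const_add (incl k w)
        have h6 : HasDerivAt (fun s : ℝ => c w + s • η) η t := by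
          simpa using ((hasDerivAt_id t).smul_const η).const_add (c w)
        have h7 := h4.comp_hasDerivAt t h5
        have h8 : (e ∘ fun s : ℝ => incl k w + s • vert k) = fun s => c w + s • η := funext het
        rw [h8] at h7
        exact h7.unique h6
      rw [hdF _ ht, h3, het, show c w = φ p from rfl]
    have h9 := h1.unique (h2.congr_of_eventuallyEq heq)
    simpa using h9
  have hcore := singular_curvature_of_curvature_ge (F := F) (ν := ν ∘ Φ) (w := w) (c := n)
    ((hFs _ hwe).of_le (by norm_cast))
    ((contMDiffAt_iff_contDiffAt.1 (hνat.comp _ (hΦat _ hwe))).of_le (by norm_cast))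
    (hUev.mono fun y hy => hν.unit _ hy.2)
    (hUev.mono fun y hy V => by
      rw [hF, fderiv_comp_mfderiv (hfd _) (hΦd y hy.1)]
      exact hν.normal _ hy.2 _)
    (by
      have h1 : ∀ᶠ x in 𝓝 w, incl k x ∈ e.source :=
        (incl k).continuous.continuousAt.preimage_mem_nhds (e.open_source.mem_nhds hwe)
      filter_upwards [h1, henull] with x hx hx'
      rw [hdF _ hx, hei]; exact hx')
    (by
      intro X Y hXY
      simp only [hdF _ hwe, heX, hei] at hXY
      exact himm hXY)
    (by
      -- If `∂ₜν` vanished, then, `∂ₜF` being zero, the differential of `(f, ν)` would kill the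
      -- non-zero vector `∂ₜ`.
      intro h0
      have hd1 : MDifferentiableAt (𝓡 (k + 1)) (𝓡 (k + 1 + 1)) ν (Φ (incl k w)) :=
        hνat.mdifferentiableAt (by simp)
      have h2 := himmν (Φ (incl k w)) (by rwa [hΦw])
      have h3 : mfderiv (𝓡 (k + 1)) (𝓡 (k + 1)) Φ (incl k w) (vert k) = 0 := by
        have hνΦ : DifferentiableAt ℝ (ν ∘ Φ) (incl k w) :=
          (hd1.comp _ (hΦd _ hwe)).differentiableAt
        have h4 : mfderiv (𝓡 (k + 1)) 𝓘(ℝ, Euc (k + 1 + 1) × Euc (k + 1 + 1))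
            ((fun q => (f q, ν q)) ∘ Φ) (incl k w) (vert k) = _ :=
          congrArg (fun l : Euc (k + 1) →L[ℝ] Euc (k + 1 + 1) × Euc (k + 1 + 1) => l (vert k))
            (mfderiv_comp (incl k w) ((hfd (Φ (incl k w))).prodMk_space hd1) (hΦd _ hwe))
        rw [mfderiv_eq_fderiv] at h4
        have h5 : fderiv ℝ ((fun q => (f q, ν q)) ∘ Φ) (incl k w) (vert k) = 0 := by
          have h6 := ((hFs _ hwe).differentiableAt (by simp)).fderiv_prodMk hνΦ
          have h7 : fderiv ℝ ((fun q => (f q, ν q)) ∘ Φ) (incl k w) = _ := h6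
          rw [h7]
          exact Prod.ext hFv0 h0
        apply h2
        rw [map_zero]
        exact h4.symm.trans h5
      have h4 : vert k = 0 := hΦinj _ hwe (h3.trans (map_zero _).symm)
      have h5 := height_vert (k := k)
      rw [h4, map_zero] at h5
      exact zero_ne_one h5)
    (by
      intro V
      rw [hdF _ hwe, hei]; exact hn _)
    (by rw [hD2]; exact hn')
    (by
      filter_upwards [hreg, nhdsWithin_le_nhds hlineB] with t h1 h2
      exact (hsing _ h2).1 h1)
    hZ hZ0 hδ hK hXY
  have hFγ : F ∘ incl k =ᶠ[𝓝 w] f ∘ γ := by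
    filter_upwards [hgc w hwW'] with x hx
    rw [hx, hFg]
    simp only [Function.comp_apply, hei]
  rwa [sectionalCurvature_congr (pullbackMetric_congr hFγ)] at hcore

end Singular

/-! ### From curvature bounds on the regular set to the singular set -/

section Main

variable {k : ℕ} {M : Type*} [TopologicalSpace M] [ChartedSpace (Euc (k + 1)) M]
  [IsManifold (𝓡 (k + 1)) ∞ M] {f : M → Euc (k + 1 + 1)}

/-- A lower bound `δ ≥ 0` of the sectional curvature on the regular set is inherited, in the
qualitative sense, by the singular set. -/
theorem singular_curvature_of_sectionalCurvatureOn_ge (hf : IsFront f)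
    (hA : ∀ p ∈ singularSet f, IsA2Point f p) {δ : ℝ} (hδ : 0 ≤ δ)
    (hK : SectionalCurvatureOn f (k + 1) (singularSet f)ᶜ (fun K => δ ≤ K)) :
    SectionalCurvatureOn f k (singularSet f) (fun K => 0 ≤ K ∧ (0 < δ → 0 < K)) := by
  intro W γ hγ w hw X Y hXY
  have hps : γ w ∈ singularSet f := hγ.mem hw
  set φ := chartAt (Euc (k + 1)) (γ w) with hφ
  have hleft : φ.symm (φ (γ w)) = γ w := φ.left_inv (mem_chart_source _ _)
  have hpt : φ (γ w) ∈ φ.target := φ.map_source (mem_chart_source _ _)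
  have hninj : ¬ Function.Injective (fderiv ℝ (f ∘ φ.symm) (φ (γ w))) := by
    rw [injective_fderiv_comp_iff (hf.1.mdifferentiable (by simp) _)
      (mdifferentiableAt_chart_symm hpt) (injective_mfderiv_chart_symm hpt), hleft]
    exact hps
  rw [injective_iff_map_eq_zero] at hninj
  push Not at hninj
  obtain ⟨η, hη, hη0⟩ := hninj
  obtain ⟨B, Φ, hBo, hwB, -, -, -, -, -, hparam, hreg, hmain⟩ :=
    exists_coordinates_at_singular hf hA hγ hw hη0 hη
  -- The bound holds on all planes, so the constant field `∂ₜ` can be used.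
  refine hmain (fun _ => vert k) δ (differentiableAt_const _) rfl hδ (fun X hX => ?_) X Y hXY
  filter_upwards [hreg, nhdsWithin_le_nhds (eventually_line (hBo.mem_nhds hwB) (vert k))]
    with t h1 h2
  exact hK _ Φ hparam _ ⟨h2, h1⟩ _ _ (linearIndependent_incl hX (by simp))

/-- A smooth vector field, read in the chart at `p`, is differentiable at `p`. -/
lemma mdifferentiableAt_mfderiv_chart_apply {O : Set M} (hO : IsOpen O) {p : M} (hp : p ∈ O)
    {η : ∀ x : M, TangentSpace (𝓡 (k + 1)) x}
    (hη : ContMDiffOn (𝓡 (k + 1)) (𝓡 (k + 1)).tangent ∞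
      (fun x => (⟨x, η x⟩ : TangentBundle (𝓡 (k + 1)) M)) O) :
    MDifferentiableAt (𝓡 (k + 1)) (𝓡 (k + 1)) (fun q =>
      (mfderiv (𝓡 (k + 1)) (𝓡 (k + 1)) (chartAt (Euc (k + 1)) p) q (η q) : Euc (k + 1))) p := by
  have h1 := (Bundle.contMDiffAt_section (F := Euc (k + 1)) p).1 (hη.contMDiffAt (hO.mem_nhds hp))
  have h2 := h1.mdifferentiableAt (by simp)
  refine h2.congr_of_eventuallyEq ?_
  have := isManifold_one (m := k + 1) (M := M)
  filter_upwards [(chartAt (Euc (k + 1)) p).open_source.mem_nhds (mem_chart_source _ p)] with q hq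
  have h3 := TangentBundle.continuousLinearMapAt_trivializationAt (I := 𝓡 (k + 1)) hq
  have h4 : mfderiv (𝓡 (k + 1)) (𝓡 (k + 1)) (chartAt (Euc (k + 1)) p) q (η q) =
    Bundle.Trivialization.continuousLinearMapAt ℝ
      (trivializationAt (Euc (k + 1)) (TangentSpace (𝓡 (k + 1))) p) q (η q) := by
    rw [h3]; rfl
  rw [h4, Bundle.Trivialization.continuousLinearMapAt_apply, Bundle.Trivialization.linearMapAt_apply,
    if_pos (by simpa using hq)]

/-- A positive lower bound, near each singular point, of the sectional curvature on the planes
containing an extended null vector makes the singular set positively curved. -/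
theorem singular_curvature_pos_of_nullCurvatureGE (hf : IsFront f)
    (hA : ∀ p ∈ singularSet f, IsA2Point f p)
    (hK : ∀ p ∈ singularSet f, ∃ (O : Set M) (η : ∀ x : M, TangentSpace (𝓡 (k + 1)) x) (δ : ℝ),
      IsOpen O ∧ p ∈ O ∧ 0 < δ ∧ IsExtendedNullField f O η ∧ NullCurvatureGE f O η δ) :
    SectionalCurvatureOn f k (singularSet f) (fun K => 0 < K) := by
  intro W γ hγ w hw X Y hXY
  have hps : γ w ∈ singularSet f := hγ.mem hw
  obtain ⟨O, η, δ, hO, hpO, hδ, hη, hKη⟩ := hK _ hps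
  have := isManifold_one (m := k + 1) (M := M)
  set φ := chartAt (Euc (k + 1)) (γ w) with hφ
  have hmd := mdifferentiable_chart (I := 𝓡 (k + 1)) (γ w)
  have hfd := hf.1.mdifferentiable (by simp)
  set ζ : M → Euc (k + 1) := fun q => mfderiv (𝓡 (k + 1)) (𝓡 (k + 1)) φ q (η q) with hζ
  have hζd : MDifferentiableAt (𝓡 (k + 1)) (𝓡 (k + 1)) ζ (γ w) :=
    mdifferentiableAt_mfderiv_chart_apply hO hpO hη.smooth
  have hζ0 : ζ (γ w) ≠ 0 := fun h =>
    hη.ne_zero _ ⟨hpO, hps⟩ (hmd.mfderiv_injective (mem_chart_source _ _)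
      (h.trans (map_zero _).symm))
  have hζnull : fderiv ℝ (f ∘ φ.symm) (φ (γ w)) (ζ (γ w)) = 0 :=
    (mfderiv_eq_fderiv_chart (mem_chart_source _ (γ w)) (hfd _) (η (γ w))).symm.trans
      (hη.null _ ⟨hpO, hps⟩)
  obtain ⟨B, Φ, hBo, hwB, hΦs, hΦsrc, hΦinj, hΦw, hΦv, hparam, hreg, hmain⟩ :=
    exists_coordinates_at_singular hf hA hγ hw hζ0 hζnull
  have hΦat : ∀ y ∈ B, ContMDiffAt (𝓡 (k + 1)) (𝓡 (k + 1)) ∞ Φ y := fun y hy =>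
    hΦs.contMDiffAt (hBo.mem_nhds hy)
  have hΦd : ∀ y ∈ B, MDifferentiableAt (𝓡 (k + 1)) (𝓡 (k + 1)) Φ y := fun y hy =>
    (hΦat y hy).mdifferentiableAt (by simp)
  have hcoord : ContDiffOn ℝ ∞ (φ ∘ Φ) B := by
    rw [← contMDiffOn_iff_contDiffOn]
    exact (contMDiffOn_chart (x := γ w) (n := ∞) (I := 𝓡 (k + 1))).comp hΦs hΦsrc
  set A : Euc (k + 1) → Euc (k + 1) →L[ℝ] Euc (k + 1) := fun y => fderiv ℝ (φ ∘ Φ) y with hAdef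
  obtain ⟨e, he⟩ := exists_equiv_of_injective (hΦinj _ hwB)
  have hAinv : DifferentiableAt ℝ (fun y => (A y).inverse) (incl k w) := by
    have h1 : ContDiffAt ℝ 1 A (incl k w) :=
      (hcoord.contDiffAt (hBo.mem_nhds hwB)).fderiv_right (by norm_cast)
    have h2 : ContDiffAt ℝ 1 ContinuousLinearMap.inverse (A (incl k w)) := by
      rw [hAdef]
      simp only
      rw [← he]
      exact contDiffAt_map_inverse e
    exact (h2.comp _ h1).differentiableAt (by norm_num)
  have hζΦ : DifferentiableAt ℝ (ζ ∘ Φ) (incl k w) :=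
    (MDifferentiableAt.comp (g := ζ) (incl k w) (by rwa [hΦw]) (hΦd _ hwB)).differentiableAt
  -- The given field expressed in the coordinates `Φ`. It equals `∂ₜ` only at the base point, which
  -- is why the coordinate theorem admits a differentiable `Z`.
  set Z' : Euc (k + 1) → Euc (k + 1) := fun y => (A y).inverse (ζ (Φ y)) with hZ'
  have hZ'd : DifferentiableAt ℝ Z' (incl k w) := hAinv.clm_apply hζΦ
  have hline : DifferentiableAt ℝ (fun t : ℝ => incl k w + t • vert k) 0 :=
    (hasDerivAt_line _ _).differentiableAt
  have hZd : DifferentiableAt ℝ (fun t : ℝ => Z' (incl k w + t • vert k)) 0 := by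
    refine DifferentiableAt.comp (g := Z') (0 : ℝ) ?_ hline
    simpa using hZ'd
  have hAZ : ∀ y ∈ B, A y (Z' y) = ζ (Φ y) := by
    intro y hy
    obtain ⟨e', he'⟩ := exists_equiv_of_injective (hΦinj y hy)
    simp only [hZ', hAdef]
    rw [← he', ContinuousLinearMap.inverse_equiv]
    simp
  have hZ0 : Z' (incl k w) = vert k := by
    refine hΦinj _ hwB ?_
    exact (hAZ _ hwB).trans ((congrArg ζ hΦw).trans hΦv.symm)
  refine (hmain (fun t => Z' (incl k w + t • vert k)) δ hZd (by simpa using hZ0) hδ.le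
    (fun X hX => ?_) X Y hXY).2 hδ
  have hOev : ∀ᶠ y in 𝓝 (incl k w), Φ y ∈ O :=
    (hΦd _ hwB).continuousAt.preimage_mem_nhds (hO.mem_nhds (by rwa [hΦw]))
  have hheight : ∀ᶠ y in 𝓝 (incl k w), height k (Z' y) ≠ 0 := by
    refine ((height k).continuous.continuousAt.comp hZ'd.continuousAt).eventually_ne ?_
    simp [hZ0]
  filter_upwards [hreg, nhdsWithin_le_nhds (eventually_line (hBo.mem_nhds hwB) (vert k)),
    nhdsWithin_le_nhds (eventually_line hOev (vert k)),
    nhdsWithin_le_nhds (eventually_line hheight (vert k))] with t h1 h2 h3 h4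
  refine hKη _ Φ hparam _ ⟨h2, h1⟩ h3 _ _ ?_ (linearIndependent_incl hX h4)
  refine hmd.mfderiv_injective (hΦsrc h2) ?_
  exact (fderiv_comp_mfderiv (mdifferentiableAt_chart (hΦsrc h2)) (hΦd _ h2) _).symm.trans
    (hAZ _ h2)

end Main

end WaveFront

open WaveFront
theorem corollary0 {m : ℕ} (hm : 3 ≤ m) {M : Type*} [TopologicalSpace M]
    [ChartedSpace (Euc m) M] [IsManifold (𝓡 m) ∞ M]
    (f : M → Euc (m + 1)) (hf : IsFront f) (hA : ∀ p ∈ singularSet f, IsA2Point f p) :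
    -- the singular set is a submanifold, and its induced metric is Riemannian
    (IsSubmanifold m (m - 1) (singularSet f) ∧ InducedMetricPosDef f (m - 1) (singularSet f)) ∧
    -- `K > 0` on the regular set
    (SectionalCurvatureOn f m (singularSet f)ᶜ (fun K => 0 < K) →
      SectionalCurvatureOn f (m - 1) (singularSet f) (fun K => 0 ≤ K)) ∧
    -- `K ≥ δ > 0` on the regular set
    (∀ δ : ℝ, 0 < δ → SectionalCurvatureOn f m (singularSet f)ᶜ (fun K => δ ≤ K) →
      SectionalCurvatureOn f (m - 1) (singularSet f) (fun K => 0 < K)) ∧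
    -- `K ≥ δ > 0`, near each singular point, on the planes containing an extended null vector
    ((∀ p ∈ singularSet f, ∃ (O : Set M) (η : ∀ x : M, TangentSpace (𝓡 m) x) (δ : ℝ),
        IsOpen O ∧ p ∈ O ∧ 0 < δ ∧ IsExtendedNullField f O η ∧ NullCurvatureGE f O η δ) →
      SectionalCurvatureOn f (m - 1) (singularSet f) (fun K => 0 < K)) := by
  -- With `m = k + 1` the dimension `m - 1` reduces to `k` by computation.
  obtain ⟨k, rfl⟩ : ∃ k, m = k + 1 := ⟨m - 1, by omega⟩
  refine ⟨⟨fun p hp => exists_isLocalParam_of_isNonDegenerate (k := k) hf.1 (hA p hp).1,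
    fun W γ hγ w hw => injective_fderiv_comp_param (k := k) hf.1 hA hγ hw⟩, fun hK => ?_,
    fun δ hδ hK => ?_, singular_curvature_pos_of_nullCurvatureGE (k := k) hf hA⟩
  · intro W γ hγ w hw X Y hXY
    -- Strict positivity enters only as the bound `δ = 0`, since strictness is lost in the limit.
    exact (singular_curvature_of_sectionalCurvatureOn_ge (k := k) hf hA le_rfl
      (fun W γ hγ w hw X Y hXY => (hK W γ hγ w hw X Y hXY).le) W γ hγ w hw X Y hXY).1
  · intro W γ hγ w hw X Y hXY
    exact (singular_curvature_of_sectionalCurvatureOn_ge (k := k) hf hA hδ.le hK W γ hγ w hw X Y hXY).2 hδ
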